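/- **Model.** Let $n\ge k$. A dynamic ring has anonymous nodes $v_0,\dots,v_{n-1}$ and links $e_i=\{v_i,v_{i+1}\}$ (indices mod $n$); in each round an adversary may remove one link. Each node has a whiteboard. There are $k$ agents with distinct IDs in $\mathbb N$, placed initially at $k$ distinct nodes; a whiteboard has one of two initial contents, according to whether an agent starts at its node. An agent is a deterministic finite automaton that may depend on its ID and on $n$, $k$ and $g$: for every bound $N$ on the IDs, finitely many agent states and whiteboard contents suffice. All agents agree on the forward direction and cannot see other agents. In every synchronous round each agent performs one atomic action: it reads the whiteboard of its current node, changes its state, rewrites the whiteboard, and stays or tries to move one node forward or backward; an agent that tries to use the missing link is blocked and remains at its node. Agents act one after another in a round, in an order chosen by the adversary. An agent in its final state never does anything again. An algorithm *solves $g$-partial gathering* if, for all choices of IDs, initial nodes, missing links and orders of the actions, all agents eventually are in their final states and then every node that holds an agent holds at least $g$ agents. The time is the number of rounds until all agents have terminated, and the number of moves is the total number of link traversals by all agents (blocked attempts do not count). **Theorem.** 1. There is an absolute constant $C$ such that for all integers $g\ge 1$ and $n\ge k\ge 8g-3$ there is an algorithm that solves the $g$-partial gathering problem for $k$ agents in dynamic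 rings with $n$ nodes, always within at most $Cn$ rounds and with at most $Cgn$ moves in total. 2. These bounds are asymptotically optimal in the worst case: there is an absolute constant $c>0$ such that for all $g\ge 2$ and $n\ge k\ge 8g-3$, every algorithm that solves the $g$-partial gathering problem for $k$ agents in dynamic rings with $n$ nodes has an execution with at least $c\,g\,n$ moves in total and, if moreover $k\le n/2$, an execution that needs at least $c\,n$ rounds. -/

import Mathlib

namespace DynamicRing

/-- The set `M = {-1, 0, 1}` of movement decisions. -/
inductive Move where
  | backward
  | stay
  | forward
  deriving DecidableEq

/-- A deterministic algorithm for agents with whiteboards.  Agent IDs are natural numbers; the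
initial state, the final state and the transition function of an agent may depend on its ID
(`State` is the union of the state sets of all agents).  `occupiedBoard` (resp. `emptyBoard`) is
the initial content of the whiteboard of a node with (resp. without) an agent. An agent sees
nothing but its own ID, its own state and the whiteboard of its current node. -/
structure Algorithm where
  State : Type
  Board : Type
  start : ℕ → State
  final : ℕ → State
  occupiedBoard : Board
  emptyBoard : Board
  step : ℕ → State → Board → State × Board × Move
  /-- an agent in its final state does nothing any more -/
  halt : ∀ (id : ℕ) (w : Board), step id (final id) w = (final id, w, Move.stay)

/-- Agents are finite automata: as soon as the IDs come from a bounded range, finitely many agent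
states and whiteboard contents suffice, i.e. there are finite sets of states and of whiteboard
contents that contain the initial and final ones and are closed under the transition functions. -/
def Algorithm.IsFinite (A : Algorithm) : Prop :=
  ∀ N : ℕ, ∃ (S : Set A.State) (W : Set A.Board), S.Finite ∧ W.Finite ∧
    A.occupiedBoard ∈ W ∧ A.emptyBoard ∈ W ∧
    ∀ id < N, A.start id ∈ S ∧ A.final id ∈ S ∧
      ∀ s ∈ S, ∀ w ∈ W, (A.step id s w).1 ∈ S ∧ (A.step id s w).2.1 ∈ W

/-- A global configuration of `k` agents on the ring with node set `ZMod n`. -/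
structure Config (A : Algorithm) (n k : ℕ) where
  state : Fin k → A.State
  board : ZMod n → A.Board
  pos : Fin k → ZMod n

/-- The node reached from `v` by the decision `m`, when the link `missing` is absent
(`none`: no link is absent).  Link `i` joins the nodes `i` and `i + 1`; forward is from `i` to
`i + 1`.  An agent that wants to use the missing link is blocked and stays where it is. -/
def dest {n : ℕ} (missing : Option (ZMod n)) (v : ZMod n) (m : Move) : ZMod n :=
  match m with
  | Move.stay => v
  | Move.forward => if missing = some v then v else v + 1
  | Move.backward => if missing = some (v - 1) then v else v - 1

/-- The atomic action of agent `a`: read the whiteboard of the current node, change the state,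
update the whiteboard, and (try to) move. -/
def act (A : Algorithm) {n k : ℕ} (ids : Fin k → ℕ) (missing : Option (ZMod n))
    (c : Config A n k) (a : Fin k) : Config A n k :=
  let r := A.step (ids a) (c.state a) (c.board (c.pos a))
  { state := Function.update c.state a r.1
    board := Function.update c.board (c.pos a) r.2.1
    pos := Function.update c.pos a (dest missing (c.pos a) r.2.2) }

/-- One synchronous round: every agent performs exactly one atomic action, in the order
`order 0, order 1, …, order (k - 1)`. -/
def round (A : Algorithm) {n k : ℕ} (ids : Fin k → ℕ) (missing : Option (ZMod n))
    (order : Equiv.Perm (Fin k)) (c : Config A n k) : Config A n k :=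
  ((List.finRange k).map order).foldl (act A ids missing) c

/-- Everything that the algorithm does not control: the distinct IDs, the distinct initial nodes,
and the choices of the adversary in each round, namely the missing link (if any) and the order of
the atomic actions. -/
structure Scenario (n k : ℕ) where
  ids : Fin k → ℕ
  ids_injective : Function.Injective ids
  home : Fin k → ZMod n
  home_injective : Function.Injective home
  missing : ℕ → Option (ZMod n)
  order : ℕ → Equiv.Perm (Fin k)

/-- The initial configuration. -/
def initial (A : Algorithm) {n k : ℕ} (E : Scenario n k) : Config A n k where
  state a := A.start (E.ids a)
  board v := if ∃ a, E.home a = v then A.occupiedBoard else A.emptyBoard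
  pos := E.home

/-- The configuration after `t` rounds. -/
def config (A : Algorithm) {n k : ℕ} (E : Scenario n k) : ℕ → Config A n k
  | 0 => initial A E
  | t + 1 => round A E.ids (E.missing t) (E.order t) (config A E t)

/-- After `t` rounds all agents have terminated. -/
def AllTerminated (A : Algorithm) {n k : ℕ} (E : Scenario n k) (t : ℕ) : Prop :=
  ∀ a, (config A E t).state a = A.final (E.ids a)

/-- At least `g` agents are at every node where there is an agent. -/
def Gathered {A : Algorithm} {n k : ℕ} (g : ℕ) (c : Config A n k) : Prop :=
  ∀ a, g ≤ (Finset.univ.filter fun b => c.pos b = c.pos a).card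

/-- The total number of agent moves (passages of a link) during the first `t` rounds. -/
def totalMoves (A : Algorithm) {n k : ℕ} (E : Scenario n k) (t : ℕ) : ℕ :=
  ∑ i ∈ Finset.range t,
    (Finset.univ.filter fun a => (config A E (i + 1)).pos a ≠ (config A E i).pos a).card

/-- `A` solves the `g`-partial gathering problem for `k` agents in dynamic rings of size `n`. -/
def Algorithm.Solves (A : Algorithm) (g n k : ℕ) : Prop :=
  ∀ E : Scenario n k, ∃ T, AllTerminated A E T ∧ Gathered g (config A E T)

/-- `A` solves the `g`-partial gathering problem for `k` agents in dynamic rings of size `n` with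
at most `rounds` rounds and at most `moves` agent moves in total. -/
def Algorithm.SolvesWithin (A : Algorithm) (g n k rounds moves : ℕ) : Prop :=
  ∀ E : Scenario n k, ∃ T ≤ rounds, AllTerminated A E T ∧ Gathered g (config A E T) ∧
    totalMoves A E T ≤ moves

end DynamicRing

/-!
# Partial gathering in dynamic rings

**Lower bounds.** An agent moves at most one node per round, so it makes at least as many moves as
the distance between its home and its final node. If the homes are equidistant, then a group of at
least `g` agents comes from an arc of length about `g * n / k`, hence at least half of its agents
make `Ω(g * n / k)` moves (`exists_many_moves`). If one agent starts far away from all the others,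
then it needs `Ω(n)` rounds to meet one of them (`exists_many_rounds`).

**Upper bounds.** The whiteboards are used as logs: in a step, which takes two rounds, every agent
first enters its ID and state and then reads who else is there and who has been there before. So the
decisions within a step do not depend on the order of the actions (`config_two_mul`), and an agent
can tell whether it has been blocked.

In the *walk*, each agent goes forward past the next `W + 1 = 4 * g - 1` homes (its own one
included), determines the smallest of their IDs, and continues to the `W`-th home beyond the owner
of that ID. It passes less than `2 * W + 1 ≤ k` homes, so it needs less than `n` moves, and every
link is passed by `O(g)` agents. Two agents that have not arrived after `2 * n` steps have been
blocked in more than half of the steps, hence simultaneously, hence at the same node, and have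
stayed together ever since. So all late agents are at one node. If there are fewer than `2 * g` of
them, then at least `2 * g` of the `4 * g - 1` agents that head for the same node because of the
globally smallest ID have arrived there. In any case some node, called a *base*, holds at least
`2 * g` agents (`exists_base`).

In the *sweep*, each base sends a forward and a backward group of between `g` and `2 * g - 1`
agents, which collect the other agents on their way, drop all but `g` members whenever they have
become `2 * g` or more, and stop at the next base. A blocked group does no harm, since it has at
least `g` members. No node is left out: otherwise the forward group of the base before it and the
backward group of the base after it would have been blocked at the same time, but one missing link
blocks both only if they face each other across it (`exists_groupPos_eq`). The groups of one
direction pass every link at most once, with less than `2 * g` agents (`sum_moves_sweep`).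
-/

namespace DynamicRing

/-! ### Rounds of an arbitrary algorithm -/

theorem foldl_act_pos_state (A : Algorithm) {n k : ℕ} (ids : Fin k → ℕ) (missing : Option (ZMod n))
    (c : Config A n k) (l : List (Fin k)) (a : Fin k) (ha : a ∉ l) :
    (l.foldl (act A ids missing) c).pos a = c.pos a ∧
      (l.foldl (act A ids missing) c).state a = c.state a := by
  induction l generalizing c with
  | nil => simp
  | cons b l ih =>
    simp only [List.mem_cons, not_or] at ha
    obtain ⟨h1, h2⟩ := ih (act A ids missing c b) ha.2
    rw [List.foldl_cons, h1, h2]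
    simp [act, Function.update_of_ne ha.1]

/-- Every agent acts exactly once in a round, so it makes a single movement decision. -/
theorem exists_round_pos (A : Algorithm) {n k : ℕ} (ids : Fin k → ℕ) (missing : Option (ZMod n))
    (order : Equiv.Perm (Fin k)) (c : Config A n k) (a : Fin k) :
    ∃ m, (round A ids missing order c).pos a = dest missing (c.pos a) m := by
  have hmem : a ∈ (List.finRange k).map order := by
    simp only [List.mem_map, List.mem_finRange, true_and]
    exact ⟨order.symm a, by simp⟩
  have hnd : ((List.finRange k).map order).Nodup :=
    (List.nodup_finRange k).map order.injective
  obtain ⟨l₁, l₂, h⟩ := List.append_of_mem hmem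
  rw [round, h]
  rw [h] at hnd
  have h1 : a ∉ l₁ := fun h' => by
    have := List.disjoint_of_nodup_append hnd h'
    simp at this
  have h2 : a ∉ l₂ := by
    have := (List.nodup_append.1 hnd).2.1
    exact (List.nodup_cons.1 this).1
  rw [List.foldl_append, List.foldl_cons, (foldl_act_pos_state A ids missing _ l₂ a h2).1]
  obtain ⟨h3, -⟩ := foldl_act_pos_state A ids missing c l₁ a h1
  exact ⟨_, by simp only [act, Function.update_self]; rw [h3]⟩

/-- A terminated configuration never changes. -/
theorem config_succ_of_allTerminated {A : Algorithm} {n k : ℕ} {E : Scenario n k} {t : ℕ}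
    (h : AllTerminated A E t) : config A E (t + 1) = config A E t := by
  rw [config, round]
  generalize (List.finRange k).map (E.order t) = l
  have hact : ∀ a, act A E.ids (E.missing t) (config A E t) a = config A E t := by
    intro a
    have h1 := h a
    simp only [act, h1, A.halt, dest, Function.update_eq_self]
    rw [← h1, Function.update_eq_self]
  induction l with
  | nil => rfl
  | cons a l ih => rw [List.foldl_cons, hact, ih]

theorem config_eq_of_allTerminated {A : Algorithm} {n k : ℕ} {E : Scenario n k} {t u : ℕ}
    (ht : AllTerminated A E t) (hu : AllTerminated A E u) : config A E t = config A E u := by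
  have key : ∀ {t : ℕ}, AllTerminated A E t → ∀ i, config A E (t + i) = config A E t := by
    intro t ht i
    induction i with
    | zero => rfl
    | succ i ih =>
      rw [← add_assoc, config_succ_of_allTerminated, ih]
      intro a
      rw [ih]
      exact ht a
  rcases le_total t u with h | h
  · obtain ⟨i, rfl⟩ := Nat.exists_eq_add_of_le h
    exact (key ht i).symm
  · obtain ⟨i, rfl⟩ := Nat.exists_eq_add_of_le h
    exact key hu i

/-- The number of moves of a single agent during the first `t` rounds. -/
def agentMoves (A : Algorithm) {n k : ℕ} (E : Scenario n k) (a : Fin k) (t : ℕ) : ℕ :=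
  ((Finset.range t).filter fun i => (config A E (i + 1)).pos a ≠ (config A E i).pos a).card

theorem totalMoves_eq_sum (A : Algorithm) {n k : ℕ} (E : Scenario n k) (t : ℕ) :
    totalMoves A E t = ∑ a, agentMoves A E a t := by
  simp only [totalMoves, agentMoves, Finset.card_filter]
  exact Finset.sum_comm

theorem agentMoves_le (A : Algorithm) {n k : ℕ} (E : Scenario n k) (a : Fin k) (t : ℕ) :
    agentMoves A E a t ≤ t :=
  (Finset.card_filter_le _ _).trans (Finset.card_range t).le

/-- The displacement of an agent is at most its number of moves. -/
theorem exists_displacement (A : Algorithm) {n k : ℕ} (E : Scenario n k) (a : Fin k) (t : ℕ) :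
    ∃ e : ℤ, |e| ≤ agentMoves A E a t ∧ (config A E t).pos a = E.home a + (e : ZMod n) := by
  induction t with
  | zero => exact ⟨0, by simp, by simp [config, initial]⟩
  | succ t ih =>
    obtain ⟨e, he, hp⟩ := ih
    have hm : agentMoves A E a (t + 1) = agentMoves A E a t +
        if (config A E (t + 1)).pos a ≠ (config A E t).pos a then 1 else 0 := by
      simp only [agentMoves, Finset.card_filter, Finset.sum_range_succ]
    by_cases hne : (config A E (t + 1)).pos a = (config A E t).pos a
    · exact ⟨e, by rw [hm]; simpa [hne] using he, by rw [hne, hp]⟩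
    · rw [if_pos hne] at hm
      obtain ⟨m, h⟩ := exists_round_pos A E.ids (E.missing t) (E.order t) (config A E t) a
      have h' : (config A E (t + 1)).pos a = dest (E.missing t) ((config A E t).pos a) m := h
      have h3 := abs_le.1 he
      rw [hm]
      cases m with
      | stay => exact absurd h' hne
      | forward =>
        refine ⟨e + 1, abs_le.2 ⟨by push_cast; omega, by push_cast; omega⟩, ?_⟩
        simp only [dest] at h'
        split_ifs at h' with h''
        · exact absurd h' hne
        · rw [h', hp]; push_cast; ring
      | backward =>
        refine ⟨e - 1, abs_le.2 ⟨by push_cast; omega, by push_cast; omega⟩, ?_⟩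
        simp only [dest] at h'
        split_ifs at h' with h''
        · exact absurd h' hne
        · rw [h', hp]; push_cast; ring

/-! ### Lower bounds -/

/-- If the points `σ * i` for `i < k` lie on the ring, pairwise at distance at least `σ`, then at
most `r` of them are at distance less than `x` from `p`, where `2 * x - 1 ≤ σ * r`. -/
theorem card_near_le {n k σ r x : ℕ} (hσ : 0 < σ) (hσk : σ * k ≤ n) (hx : 2 * x ≤ σ * r + 1)
    (p : ZMod n) (S : Finset (Fin k))
    (hS : ∀ i ∈ S, ∃ e : ℤ, |e| < x ∧ p = ((σ * (i : ℕ) : ℕ) : ZMod n) + (e : ZMod n)) :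
    S.card ≤ r := by
  choose! e he hp using hS
  rw [← Finset.card_range r]
  refine Finset.card_le_card_of_injOn (fun i => (x - 1 - e i).toNat / σ) ?_ ?_
  · intro i hi
    have := abs_lt.1 (he i hi)
    simp only [Finset.coe_range, Set.mem_Iio]
    rw [Nat.div_lt_iff_lt_mul hσ, mul_comm]
    omega
  · intro i hi j hj hij
    have h1 := abs_lt.1 (he i hi)
    have h2 := abs_lt.1 (he j hj)
    have hclose : |e j - e i| < σ := by
      have hq := Nat.div_add_mod (x - 1 - e i).toNat σ
      have hq' := Nat.div_add_mod (x - 1 - e j).toNat σ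
      have hl := Nat.mod_lt (x - 1 - e i).toNat hσ
      have hl' := Nat.mod_lt (x - 1 - e j).toNat hσ
      simp only at hij
      rw [hij] at hq
      rw [abs_lt]
      constructor <;> omega
    have h3 : (((σ * (i : ℕ) : ℕ) + e i - ((σ * (j : ℕ) : ℕ) + e j) : ℤ) : ZMod n) = 0 := by
      have h4 := (hp i hi).symm.trans (hp j hj)
      push_cast at h4 ⊢
      rw [h4, sub_self]
    rw [ZMod.intCast_zmod_eq_zero_iff_dvd] at h3
    have hi' : σ * (i : ℕ) + σ ≤ n := by
      calc σ * (i : ℕ) + σ = σ * (i + 1) := by ring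
        _ ≤ σ * k := Nat.mul_le_mul_left _ i.2
        _ ≤ n := hσk
    have hj' : σ * (j : ℕ) + σ ≤ n := by
      calc σ * (j : ℕ) + σ = σ * (j + 1) := by ring
        _ ≤ σ * k := Nat.mul_le_mul_left _ j.2
        _ ≤ n := hσk
    have h5 := abs_lt.1 hclose
    have h6 := Int.eq_zero_of_abs_lt_dvd h3 (by rw [abs_lt]; constructor <;> omega)
    have h7 : (σ : ℤ) * (i - j) = e j - e i := by push_cast at h6; linarith
    have h8 : ((i : ℕ) : ℤ) - (j : ℕ) = 0 := by
      by_contra hne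
      have h9 : 1 ≤ |((i : ℕ) : ℤ) - (j : ℕ)| := Int.one_le_abs hne
      rw [← h7, abs_mul, Nat.abs_cast] at hclose
      nlinarith
    exact Fin.ext (by omega)

/-- With equidistant homes at distance `σ`, at most half of the agents of each final group come from
homes closer than about `σ * g / 4`, so at least `k / 2` agents make `Ω(g * n / k)` moves. -/
theorem exists_many_moves {g n k : ℕ} (hg : 2 ≤ g) (hk : 0 < k) (hgk : k ≤ n)
    (A : Algorithm) (hA : A.Solves g n k) :
    ∃ E : Scenario n k, ∀ T, AllTerminated A E T → g * n ≤ 24 * totalMoves A E T := by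
  have hn : 0 < n := hk.trans_le hgk
  set σ := n / k with hσdef
  have hσ : 0 < σ := Nat.div_pos hgk hk
  have hσk : σ * k ≤ n := Nat.div_mul_le_self n k
  let E : Scenario n k :=
    { ids := fun i => i
      ids_injective := Fin.val_injective
      home := fun i => ((σ * (i : ℕ) : ℕ) : ZMod n)
      home_injective := by
        intro i j hij
        have hlt : ∀ i : Fin k, σ * (i : ℕ) < n := fun i =>
          (Nat.mul_lt_mul_of_pos_left i.2 hσ).trans_le hσk
        have h := (ZMod.natCast_eq_natCast_iff' _ _ _).1 hij
        rw [Nat.mod_eq_of_lt (hlt i), Nat.mod_eq_of_lt (hlt j)] at h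
        exact Fin.ext (Nat.eq_of_mul_eq_mul_left hσ h)
      missing := fun _ => none
      order := fun _ => 1 }
  refine ⟨E, fun T hT => ?_⟩
  obtain ⟨T', hT', hG⟩ := hA E
  rw [config_eq_of_allTerminated hT' hT] at hG
  set P := (config A E T).pos with hP
  -- an arc of `2 * x - 1 ≤ σ * r` nodes contains at most `r` homes
  set r := g / 2 with hr
  set x := (σ * r + 1) / 2 with hx
  let short : Finset (Fin k) := Finset.univ.filter fun a => agentMoves A E a T < x
  have hshort : ∀ p, (short.filter fun a => P a = p).card ≤ r := by
    intro p
    refine card_near_le (x := x) hσ hσk (by omega) p _ fun a ha => ?_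
    simp only [short, Finset.mem_filter, Finset.mem_univ, true_and] at ha
    obtain ⟨e, he, hpe⟩ := exists_displacement A E a T
    exact ⟨e, by omega, by rw [← ha.2]; exact hpe⟩
  have hhalf : 2 * short.card ≤ k := by
    have h1 : short.card = ∑ p ∈ Finset.univ.image P, (short.filter fun a => P a = p).card :=
      Finset.card_eq_sum_card_fiberwise (fun a _ => by simp)
    have h2 : k = ∑ p ∈ Finset.univ.image P, (Finset.univ.filter fun a => P a = p).card := by
      conv_lhs => rw [← Finset.card_fin k]
      exact Finset.card_eq_sum_card_fiberwise (fun a _ => by simp)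
    rw [h1, Finset.mul_sum]
    refine le_of_le_of_eq (Finset.sum_le_sum fun p hp => ?_) h2.symm
    obtain ⟨a, -, rfl⟩ := Finset.mem_image.1 hp
    have := hshort (P a)
    have := hG a
    simp only [← hP] at this
    omega
  have hsum : (k - short.card) * x ≤ totalMoves A E T := by
    rw [totalMoves_eq_sum]
    have hc : (Finset.univ.filter fun a => ¬ agentMoves A E a T < x).card = k - short.card := by
      have := Finset.card_filter_add_card_filter_not (s := (Finset.univ : Finset (Fin k)))
        (fun a => agentMoves A E a T < x)
      rw [Finset.card_fin] at this
      simp only [short]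
      omega
    calc (k - short.card) * x
        = ∑ a ∈ Finset.univ.filter (fun a => ¬ agentMoves A E a T < x), x := by
          rw [Finset.sum_const, hc, smul_eq_mul]
      _ ≤ ∑ a ∈ Finset.univ.filter (fun a => ¬ agentMoves A E a T < x), agentMoves A E a T :=
          Finset.sum_le_sum fun a ha => by simpa using ha
      _ ≤ _ := Finset.sum_le_sum_of_subset (Finset.filter_subset _ _)
  have hn2 : n ≤ 2 * (k * σ) := by
    have h1 : n < k * (σ + 1) := Nat.lt_mul_div_succ n hk
    nlinarith
  have hx2 : σ * r ≤ 2 * x := by omega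
  have hr3 : g ≤ 3 * r := by omega
  have h4 : k * (σ * r) ≤ 4 * totalMoves A E T :=
    calc k * (σ * r) ≤ (2 * (k - short.card)) * (2 * x) := Nat.mul_le_mul (by omega) hx2
      _ = 4 * ((k - short.card) * x) := by ring
      _ ≤ _ := Nat.mul_le_mul_left _ hsum
  calc g * n ≤ (3 * r) * (2 * (k * σ)) := Nat.mul_le_mul hr3 hn2
    _ = 6 * (k * (σ * r)) := by ring
    _ ≤ 6 * (4 * totalMoves A E T) := Nat.mul_le_mul_left _ h4
    _ = _ := by ring

/-- One agent starts at distance at least `n / 4` from all others, and must meet one of them. -/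
theorem exists_many_rounds {g n k : ℕ} (hg : 2 ≤ g) (hk : 2 ≤ k) (hkn : 2 * k ≤ n)
    (A : Algorithm) (hA : A.Solves g n k) :
    ∃ E : Scenario n k, ∀ T, AllTerminated A E T → n ≤ 8 * T := by
  -- the node of the lone agent, in the middle of the arc that the others leave free
  set q := (n + k) / 2 with hq
  let f : Fin k → ℕ := fun i => if (i : ℕ) + 1 = k then q else i
  have hf : ∀ i, f i < n := fun i => by simp only [f]; split_ifs <;> omega
  let E : Scenario n k :=
    { ids := fun i => i
      ids_injective := Fin.val_injective
      home := fun i => (f i : ZMod n)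
      home_injective := by
        intro i j hij
        have h := (ZMod.natCast_eq_natCast_iff' _ _ _).1 hij
        rw [Nat.mod_eq_of_lt (hf i), Nat.mod_eq_of_lt (hf j)] at h
        have := i.2
        have := j.2
        simp only [f] at h
        apply Fin.ext
        split_ifs at h <;> omega
      missing := fun _ => none
      order := fun _ => 1 }
  refine ⟨E, fun T hT => ?_⟩
  obtain ⟨T', hT', hG⟩ := hA E
  rw [config_eq_of_allTerminated hT' hT] at hG
  let a : Fin k := ⟨k - 1, by omega⟩
  obtain ⟨b, hb, hba⟩ := Finset.exists_mem_ne (lt_of_lt_of_le hg (hG a)) a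
  obtain ⟨e, he, hpe⟩ := exists_displacement A E a T
  obtain ⟨e', he', hpe'⟩ := exists_displacement A E b T
  have h1 := agentMoves_le A E a T
  have h2 := agentMoves_le A E b T
  have hbk : (b : ℕ) + 1 ≠ k := fun h => hba (Fin.ext (by simp only [a]; omega))
  have hfa : f a = q := if_pos (by simp only [a]; omega)
  have hfb : f b = b := if_neg hbk
  have h3 : (((q : ℕ) + e - ((b : ℕ) + e') : ℤ) : ZMod n) = 0 := by
    have h4 := hpe.symm.trans ((Finset.mem_filter.1 hb).2.symm.trans hpe')
    simp only [E, hfa, hfb] at h4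
    push_cast
    rw [h4, sub_self]
  rw [ZMod.intCast_zmod_eq_zero_iff_dvd] at h3
  have he := abs_le.1 he
  have he' := abs_le.1 he'
  have := b.2
  by_contra hlt
  have h5 := Int.eq_zero_of_abs_lt_dvd h3 (by rw [abs_lt]; constructor <;> omega)
  omega

/-! ### Algorithms that keep a log on the whiteboards -/

/-- A log on a whiteboard: for every step, the IDs and the states of the agents that were at the
node at the beginning of that step. -/
abbrev Log (σ : Type) := ℕ → Set (ℕ × σ)

/-- A decision rule: from the number of the step, the own ID, the own state and the log of the
current node it determines the new state and the movement. -/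
abbrev Rule (σ : Type) := ℕ → ℕ → σ → Log σ → σ × Move

/-- The algorithm that carries out `T` steps of a decision rule. A step takes two rounds: in the
first one every agent enters itself into the log of its node, in the second one it reads the log,
which then lists everybody at the node, and moves. In the state `some (τ, b, s)` of an agent, `τ` is
the number of the step, `b` tells whether the entry into the log has been made, and `s` is the state
that the rule works with. -/
def logAlgorithm {σ : Type} (init : σ) (T : ℕ) (rule : Rule σ) : Algorithm where
  State := Option (ℕ × Bool × σ)
  Board := Log σ
  start _ := some (0, false, init)
  final _ := none
  occupiedBoard _ := ∅
  emptyBoard _ := ∅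
  step id q w :=
    match q with
    | none => (none, w, Move.stay)
    | some (τ, false, s) =>
      (some (τ, true, s), Function.update w τ (insert (id, s) (w τ)), Move.stay)
    | some (τ, true, s) =>
      (if τ + 1 < T then some (τ + 1, false, (rule τ id s w).1) else none, w, (rule τ id s w).2)
  halt _ _ := rfl

theorem finite_setOf_log {α : Type} {P : Set α} (hP : P.Finite) (T : ℕ) :
    {w : ℕ → Set α | (∀ τ, w τ ⊆ P) ∧ ∀ τ, T ≤ τ → w τ = ∅}.Finite := by
  have h1 : (Set.pi Set.univ fun _ : Fin T => {s : Set α | s ⊆ P}).Finite :=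
    Set.Finite.pi fun _ => hP.finite_subsets
  refine Set.Finite.of_finite_image (f := fun w (i : Fin T) => w i) (h1.subset ?_) ?_
  · rintro _ ⟨w, hw, rfl⟩ i -
    exact hw.1 i
  · intro w hw w' hw' h
    funext τ
    by_cases hτ : τ < T
    · exact congrFun h ⟨τ, hτ⟩
    · rw [hw.2 τ (not_lt.1 hτ), hw'.2 τ (not_lt.1 hτ)]

theorem logAlgorithm_isFinite {σ : Type} (init : σ) {T : ℕ} (hT : 0 < T) (rule : Rule σ)
    (h : ∀ N, ∃ S : Set σ, S.Finite ∧ init ∈ S ∧ ∀ id < N, ∀ s ∈ S, ∀ w : Log σ,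
      (∀ τ, ∀ p ∈ w τ, p.1 < N ∧ p.2 ∈ S) → ∀ τ, (rule τ id s w).1 ∈ S) :
    (logAlgorithm init T rule).IsFinite := by
  intro N
  obtain ⟨S, hS, hinit, hstep⟩ := h N
  have hP : (Set.Iio N ×ˢ S).Finite := (Set.finite_Iio N).prod hS
  refine ⟨insert none (some '' (Set.Iio T ×ˢ (Set.univ ×ˢ S))),
    {w | (∀ τ, w τ ⊆ Set.Iio N ×ˢ S) ∧ ∀ τ, T ≤ τ → w τ = ∅},
    (((Set.finite_Iio T).prod (Set.finite_univ.prod hS)).image _).insert _, finite_setOf_log hP T,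
    ⟨fun _ => Set.empty_subset _, fun _ _ => rfl⟩, ⟨fun _ => Set.empty_subset _, fun _ _ => rfl⟩,
    fun id hid => ⟨Or.inr ⟨(0, false, init), ⟨hT, trivial, hinit⟩, rfl⟩, Or.inl rfl, ?_⟩⟩
  rintro _ (rfl | ⟨⟨τ, b, s⟩, ⟨hτ, -, hs⟩, rfl⟩) (w : Log σ) ⟨hw, hw'⟩
  · exact ⟨Or.inl rfl, hw, hw'⟩
  · simp only [Set.mem_Iio] at hτ
    cases b with
    | false =>
      refine ⟨Or.inr ⟨(τ, true, s), ⟨hτ, trivial, hs⟩, rfl⟩, fun τ' => ?_, fun τ' hτ' => ?_⟩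
      · simp only [logAlgorithm, Function.update_apply]
        split_ifs with heq
        · exact Set.insert_subset ⟨hid, hs⟩ (hw τ)
        · exact hw τ'
      · simp only [logAlgorithm, Function.update_apply]
        rw [if_neg (by omega), hw' τ' hτ']
    | true =>
      refine ⟨?_, hw, hw'⟩
      simp only [logAlgorithm]
      split_ifs with hlt
      · exact Or.inr ⟨(τ + 1, false, (rule τ id s w).1),
          ⟨hlt, trivial, hstep id hid s hs w (fun τ' p hp => hw τ' hp) τ⟩, rfl⟩
      · exact Or.inl rfl

/-- The states and positions of all agents and the logs of all nodes between two steps. -/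
structure Snapshot (σ : Type) (n k : ℕ) where
  state : Fin k → σ
  pos : Fin k → ZMod n
  log : ZMod n → Log σ

/-- The logs after every agent has entered itself in step `τ`. -/
def Snapshot.register {σ : Type} {n k : ℕ} (m : Snapshot σ n k) (ids : Fin k → ℕ) (τ : ℕ)
    (v : ZMod n) : Log σ :=
  Function.update (m.log v) τ (m.log v τ ∪ {p | ∃ a, m.pos a = v ∧ (ids a, m.state a) = p})

/-- The effect of the steps of a rule. Only the link that is missing in the second round of a step
matters. -/
def snapshot {σ : Type} {n k : ℕ} (init : σ) (rule : Rule σ) (E : Scenario n k) :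
    ℕ → Snapshot σ n k
  | 0 => ⟨fun _ => init, E.home, fun _ _ => ∅⟩
  | τ + 1 =>
    let m := snapshot init rule E τ
    let w := m.register E.ids τ
    ⟨fun a => (rule τ (E.ids a) (m.state a) (w (m.pos a))).1,
      fun a => dest (E.missing (2 * τ + 1)) (m.pos a) (rule τ (E.ids a) (m.state a) (w (m.pos a))).2,
      w⟩

theorem foldl_act_register {σ : Type} {n k : ℕ} (init : σ) (T : ℕ) (rule : Rule σ)
    (ids : Fin k → ℕ) (missing : Option (ZMod n)) (τ : ℕ) (m : Snapshot σ n k)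
    (l : List (Fin k)) (hl : l.Nodup) :
    l.foldl (act (logAlgorithm init T rule) ids missing)
      ⟨fun a => some (τ, false, m.state a), m.log, m.pos⟩ =
      ⟨fun a => some (τ, decide (a ∈ l), m.state a),
        fun v => Function.update (m.log v) τ
          (m.log v τ ∪ {p | ∃ a ∈ l, m.pos a = v ∧ (ids a, m.state a) = p}), m.pos⟩ := by
  induction l using List.reverseRecOn with
  | nil => simp
  | append_singleton l a ih =>
    have hnd := List.nodup_append.1 hl
    have hal : a ∉ l := fun h => hnd.2.2 a h a (by simp) rfl
    rw [List.foldl_append, ih hnd.1, List.foldl_cons, List.foldl_nil]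
    simp only [act, logAlgorithm, hal, decide_false]
    congr 1
    · funext b
      by_cases hb : b = a
      · subst hb; simp
      · simp [hb]
    · funext v
      by_cases hv : v = m.pos a
      · subst hv
        simp only [Function.update_self, Function.update_idem]
        congr 1
        ext p
        simp only [Set.mem_insert_iff, Set.mem_union, Set.mem_ofPred_eq, List.mem_append,
          List.mem_singleton]
        constructor
        · rintro (rfl | h | ⟨b, hb, h⟩)
          · exact Or.inr ⟨a, Or.inr rfl, rfl, rfl⟩
          · exact Or.inl h
          · exact Or.inr ⟨b, Or.inl hb, h⟩
        · rintro (h | ⟨b, hb | rfl, h⟩)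
          · exact Or.inr (Or.inl h)
          · exact Or.inr (Or.inr ⟨b, hb, h⟩)
          · exact Or.inl h.2.symm
      · rw [Function.update_of_ne hv]
        congr 2
        ext p
        simp only [Set.mem_ofPred_eq, List.mem_append, List.mem_singleton]
        constructor
        · rintro ⟨b, hb, h⟩
          exact ⟨b, Or.inl hb, h⟩
        · rintro ⟨b, hb | rfl, h⟩
          · exact ⟨b, hb, h⟩
          · exact absurd h.1.symm hv
    · simp [dest]

theorem foldl_act_decide {σ : Type} {n k : ℕ} (init : σ) (T : ℕ) (rule : Rule σ)
    (ids : Fin k → ℕ) (missing : Option (ZMod n)) (τ : ℕ) (m : Snapshot σ n k)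
    (l : List (Fin k)) (hl : l.Nodup) :
    l.foldl (act (logAlgorithm init T rule) ids missing)
      ⟨fun a => some (τ, true, m.state a), m.log, m.pos⟩ =
      ⟨fun a => if a ∈ l then
          (if τ + 1 < T then
            some (τ + 1, false, (rule τ (ids a) (m.state a) (m.log (m.pos a))).1) else none)
          else some (τ, true, m.state a), m.log,
        fun a => if a ∈ l then
          dest missing (m.pos a) (rule τ (ids a) (m.state a) (m.log (m.pos a))).2 else m.pos a⟩ := by
  induction l using List.reverseRecOn with
  | nil => simp
  | append_singleton l a ih =>
    have hnd := List.nodup_append.1 hl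
    have hal : a ∉ l := fun h => hnd.2.2 a h a (by simp) rfl
    rw [List.foldl_append, ih hnd.1, List.foldl_cons, List.foldl_nil]
    simp only [act, logAlgorithm, hal, if_false]
    congr 1
    · funext b
      by_cases hb : b = a
      · subst hb; simp
      · simp [hb]
    · simp
    · funext b
      by_cases hb : b = a
      · subst hb; simp
      · simp [hb]

section Simulation

variable {σ : Type} {n k : ℕ} (init : σ) (T : ℕ) (rule : Rule σ) (E : Scenario n k)

theorem nodup_order (e : Equiv.Perm (Fin k)) : ((List.finRange k).map e).Nodup :=
  (List.nodup_finRange k).map e.injective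

theorem mem_order (e : Equiv.Perm (Fin k)) (a : Fin k) : a ∈ (List.finRange k).map e := by
  simp only [List.mem_map, List.mem_finRange, true_and]
  exact ⟨e.symm a, by simp⟩

theorem config_register {τ : ℕ} (h : config (logAlgorithm init T rule) E (2 * τ) =
    ⟨fun a => some (τ, false, (snapshot init rule E τ).state a), (snapshot init rule E τ).log,
      (snapshot init rule E τ).pos⟩) :
    config (logAlgorithm init T rule) E (2 * τ + 1) =
    ⟨fun a => some (τ, true, (snapshot init rule E τ).state a),
      (snapshot init rule E τ).register E.ids τ, (snapshot init rule E τ).pos⟩ := by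
  rw [config, h, round, foldl_act_register _ _ _ _ _ _ _ _ (nodup_order _)]
  simp only [mem_order, decide_true, true_and]
  rfl

/-- The configurations of `logAlgorithm` at even times. -/
theorem config_two_mul (hT : 0 < T) {τ : ℕ} (hτ : τ ≤ T) :
    config (logAlgorithm init T rule) E (2 * τ) =
    ⟨fun a => if τ < T then some (τ, false, (snapshot init rule E τ).state a) else none,
      (snapshot init rule E τ).log, (snapshot init rule E τ).pos⟩ := by
  induction τ with
  | zero =>
    simp only [hT, if_true, config, initial, snapshot, logAlgorithm, ite_self]
  | succ τ ih =>
    have ih := ih (by omega)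
    simp only [show τ < T by omega] at ih
    rw [show 2 * (τ + 1) = 2 * τ + 1 + 1 by ring, config, config_register init T rule E ih, round]
    have h := foldl_act_decide init T rule E.ids (E.missing (2 * τ + 1)) τ
      ⟨(snapshot init rule E τ).state, (snapshot init rule E τ).pos,
        (snapshot init rule E τ).register E.ids τ⟩ _ (nodup_order (E.order (2 * τ + 1)))
    simp only [mem_order, if_true] at h
    exact h

theorem allTerminated_logAlgorithm (hT : 0 < T) :
    AllTerminated (logAlgorithm init T rule) E (2 * T) := by
  intro a
  rw [config_two_mul init T rule E hT le_rfl]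
  simp [logAlgorithm]

theorem totalMoves_logAlgorithm (hT : 0 < T) {τ : ℕ} (hτ : τ ≤ T) :
    totalMoves (logAlgorithm init T rule) E (2 * τ) = ∑ i ∈ Finset.range τ,
      (Finset.univ.filter fun a =>
        (snapshot init rule E (i + 1)).pos a ≠ (snapshot init rule E i).pos a).card := by
  induction τ with
  | zero => simp [totalMoves]
  | succ τ ih =>
    have h0 := config_two_mul init T rule E hT (show τ ≤ T by omega)
    have h2 := config_two_mul init T rule E hT hτ
    have h1 := config_register init T rule E (by simpa [show τ < T by omega] using h0)
    rw [Finset.sum_range_succ, ← ih (by omega), show 2 * (τ + 1) = 2 * τ + 1 + 1 by ring,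
      totalMoves, Finset.sum_range_succ, Finset.sum_range_succ]
    rw [show 2 * (τ + 1) = 2 * τ + 1 + 1 by ring] at h2
    simp only [h0, h1, h2, totalMoves]
    simp

/-- Entries are never removed from the logs. -/
theorem mem_snapshot_log {τ τ' : ℕ} {v : ZMod n} {p : ℕ × σ} :
    p ∈ (snapshot init rule E τ).log v τ' ↔ τ' < τ ∧
      ∃ a, (snapshot init rule E τ').pos a = v ∧ (E.ids a, (snapshot init rule E τ').state a) = p := by
  induction τ with
  | zero => simp [snapshot]
  | succ τ ih =>
    rw [snapshot]
    simp only [Snapshot.register, Function.update_apply]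
    split_ifs with h
    · subst h
      simp [Set.mem_union, ih]
    · rw [ih]
      exact and_congr_left fun _ => by omega

theorem mem_snapshot_register {τ τ' : ℕ} {v : ZMod n} {p : ℕ × σ} :
    p ∈ (snapshot init rule E τ).register E.ids τ v τ' ↔ τ' ≤ τ ∧
      ∃ a, (snapshot init rule E τ').pos a = v ∧ (E.ids a, (snapshot init rule E τ').state a) = p := by
  rw [← Nat.lt_succ_iff, ← mem_snapshot_log init rule E]
  rfl

end Simulation

/-! ### Walks against an adversary, and ranks -/

open Classical in
/-- The distance covered after `t` steps by a walker that advances by one in every step, except when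
it has reached a distance at which it stops for good, or is blocked at the current distance. -/
noncomputable def walk (goal : ℕ → Prop) (blocked : ℕ → ℕ → Prop) : ℕ → ℕ
  | 0 => 0
  | t + 1 =>
    if goal (walk goal blocked t) ∨ blocked t (walk goal blocked t) then walk goal blocked t
    else walk goal blocked t + 1

section Walk

variable {goal : ℕ → Prop} {blocked : ℕ → ℕ → Prop}

theorem walk_succ_of_or {t : ℕ}
    (h : goal (walk goal blocked t) ∨ blocked t (walk goal blocked t)) :
    walk goal blocked (t + 1) = walk goal blocked t := by
  rw [walk, if_pos h]

theorem walk_succ_of_not {t : ℕ} (h : ¬ goal (walk goal blocked t))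
    (h' : ¬ blocked t (walk goal blocked t)) :
    walk goal blocked (t + 1) = walk goal blocked t + 1 := by
  rw [walk, if_neg (by tauto)]

theorem walk_succ_eq_or (t : ℕ) : walk goal blocked (t + 1) = walk goal blocked t ∨
    walk goal blocked (t + 1) = walk goal blocked t + 1 := by
  rw [walk]
  split_ifs <;> simp

theorem walk_mono : Monotone (walk goal blocked) :=
  monotone_nat_of_le_succ fun t => by
    rcases walk_succ_eq_or (goal := goal) (blocked := blocked) t with h | h <;> omega

theorem walk_le (t : ℕ) : walk goal blocked t ≤ t := by
  induction t with
  | zero => simp [walk]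
  | succ t ih =>
    rcases walk_succ_eq_or (goal := goal) (blocked := blocked) t with h | h <;> omega

theorem not_goal_of_lt_walk {t i : ℕ} (h : i < walk goal blocked t) : ¬ goal i := by
  induction t with
  | zero => simp [walk] at h
  | succ t ih =>
    by_cases h' : i < walk goal blocked t
    · exact ih h'
    · rw [walk] at h
      split_ifs at h with h''
      · exact absurd h h'
      · obtain rfl : i = walk goal blocked t := by omega
        tauto

theorem exists_walk_eq {t m : ℕ} (h : m ≤ walk goal blocked t) :
    ∃ u ≤ t, walk goal blocked u = m := by
  induction t with
  | zero => exact ⟨0, le_rfl, by simp [walk] at h ⊢; exact h.symm⟩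
  | succ t ih =>
    by_cases h' : m ≤ walk goal blocked t
    · obtain ⟨u, hu, hw⟩ := ih h'
      exact ⟨u, by omega, hw⟩
    · refine ⟨t + 1, le_rfl, ?_⟩
      rcases walk_succ_eq_or (goal := goal) (blocked := blocked) t with h'' | h'' <;> omega

open Classical in
theorem walk_add_card_blocked {T : ℕ} (h : ¬ goal (walk goal blocked T)) :
    walk goal blocked T +
      ((Finset.range T).filter fun t => blocked t (walk goal blocked t)).card = T := by
  induction T with
  | zero => simp [walk]
  | succ T ih =>
    have hT : ¬ goal (walk goal blocked T) := by
      rcases walk_succ_eq_or (goal := goal) (blocked := blocked) T with h' | h'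
      · rwa [← h']
      · exact not_goal_of_lt_walk (blocked := blocked) (t := T + 1) (by omega)
    have ih := ih hT
    rw [Finset.range_add_one, Finset.filter_insert]
    by_cases hb : blocked T (walk goal blocked T)
    · rw [if_pos hb, Finset.card_insert_of_notMem (by simp), walk_succ_of_or (Or.inr hb)]
      omega
    · rw [if_neg hb, walk_succ_of_not hT hb]
      omega

/-- Two walkers that have not reached their goals, although there were more steps than they have
covered together, have been blocked simultaneously in some step. -/
theorem exists_both_blocked {goal' : ℕ → Prop} {blocked' : ℕ → ℕ → Prop} {T : ℕ}
    (h : ¬ goal (walk goal blocked T)) (h' : ¬ goal' (walk goal' blocked' T))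
    (hT : walk goal blocked T + walk goal' blocked' T < T) :
    ∃ t < T, blocked t (walk goal blocked t) ∧ blocked' t (walk goal' blocked' t) := by
  classical
  have h1 := walk_add_card_blocked h
  have h2 := walk_add_card_blocked h'
  set S := (Finset.range T).filter fun t => blocked t (walk goal blocked t)
  set S' := (Finset.range T).filter fun t => blocked' t (walk goal' blocked' t)
  by_contra! hne
  have hd : Disjoint S S' := by
    rw [Finset.disjoint_left]
    intro t ht ht'
    simp only [S, S', Finset.mem_filter, Finset.mem_range] at ht ht'
    exact hne t ht.1 ht.2 ht'.2
  have h3 : (S ∪ S').card ≤ T := by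
    simpa using Finset.card_le_card
      (Finset.union_subset (Finset.filter_subset _ _) (Finset.filter_subset _ _) :
        S ∪ S' ⊆ Finset.range T)
  rw [Finset.card_union_of_disjoint hd] at h3
  omega

end Walk

/-- Among the elements of a finite set, ranked by `d`, the first `r` are exactly `r` many. -/
theorem ncard_rank_lt {α : Type*} [Finite α] {d : α → ℕ} (hd : Function.Injective d) (S : Set α)
    (r : ℕ) :
    {a ∈ S | {b ∈ S | d b < d a}.ncard < r}.ncard = min r S.ncard := by
  let f : α → ℕ := fun a => {b ∈ S | d b < d a}.ncard
  have hlt : ∀ a ∈ S, ∀ b, d a < d b → f a < f b := fun a ha b hab =>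
    Set.ncard_lt_ncard ⟨fun c hc => ⟨hc.1, hc.2.trans hab⟩,
      fun h => lt_irrefl _ (h (show a ∈ {c ∈ S | d c < d b} from ⟨ha, hab⟩)).2⟩ (Set.toFinite _)
  have hinj : Set.InjOn f S := by
    intro a ha b hb hab
    rcases lt_trichotomy (d a) (d b) with h | h | h
    · exact absurd hab (hlt a ha b h).ne
    · exact hd h
    · exact absurd hab (hlt b hb a h).ne'
  have himage : f '' S = Set.Iio S.ncard := by
    refine Set.eq_of_subset_of_ncard_le ?_ ?_ (Set.toFinite _)
    · rintro _ ⟨a, ha, rfl⟩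
      exact Set.ncard_lt_ncard ⟨fun c hc => hc.1, fun h => lt_irrefl _ (h ha).2⟩ (Set.toFinite _)
    · rw [hinj.ncard_image]
      simp [Set.ncard_eq_toFinset_card']
  have hsub : {a ∈ S | f a < r} ⊆ S := fun a ha => ha.1
  have h2 : f '' {a ∈ S | f a < r} = Set.Iio (min r S.ncard) := by
    ext x
    rw [Set.mem_Iio, lt_min_iff, show x < S.ncard ↔ x ∈ f '' S by rw [himage]; rfl]
    constructor
    · rintro ⟨a, ha, rfl⟩
      exact ⟨ha.2, a, ha.1, rfl⟩
    · rintro ⟨hx, a, ha, rfl⟩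
      exact ⟨a, ⟨ha, hx⟩, rfl⟩
  change {a ∈ S | f a < r}.ncard = _
  rw [← (hinj.mono hsub).ncard_image, h2]
  simp [Set.ncard_eq_toFinset_card']

theorem ncard_le_rank {α : Type*} [Finite α] {d : α → ℕ} (hd : Function.Injective d) (S : Set α)
    (r : ℕ) :
    {a ∈ S | r ≤ {b ∈ S | d b < d a}.ncard}.ncard = S.ncard - r := by
  have h1 := ncard_rank_lt hd S r
  have h2 : {a ∈ S | r ≤ {b ∈ S | d b < d a}.ncard} =
      S \ {a ∈ S | {b ∈ S | d b < d a}.ncard < r} := by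
    ext a
    simp only [Set.mem_ofPred_eq, Set.mem_sdiff, not_and, not_lt]
    tauto
  rw [h2, Set.ncard_sdiff (fun a ha => ha.1) (Set.toFinite _), h1]
  omega

/-! ### The decision rule -/

/-- The state of an agent: `walking o F` while it looks for its target, where `o` is its distance
from its home and `F` consists of the pairs (distance from home, ID) of the homes that it has seen;
`idle` if it waits to be collected; `moving d x` if it belongs to the forward (`d = true`) or the
backward (`d = false`) group called `x`; `settled` if it will not move again. -/
inductive AgentState (n : ℕ) where
  | walking (o : ZMod n) (F : Set (ZMod n × ℕ))
  | idle
  | moving (d : Bool) (x : ℕ)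
  | settled

/-- The move of a forward or backward group. -/
def heading : Bool → Move
  | true => Move.forward
  | false => Move.backward

/-- The IDs of the agents that were at the node in step `τ`. -/
def idsAt {σ : Type} (w : Log σ) (τ : ℕ) : Set ℕ := {i | ∃ s, (i, s) ∈ w τ}

/-- The condition under which a walking agent that has seen the homes `F` stays where it is: the
home `p` with the smallest ID among the first `W + 1` homes of `F` is followed by at least `W` homes
of `F`. -/
def AtTarget {n : ℕ} (W : ℕ) (F : Set (ZMod n × ℕ)) : Prop :=
  ∃ p ∈ F, {q ∈ F | q.1.val < p.1.val}.ncard ≤ W ∧ W ≤ {q ∈ F | p.1.val < q.1.val}.ncard ∧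
    ∀ q ∈ F, {r ∈ F | r.1.val < q.1.val}.ncard ≤ W → p.2 ≤ q.2

open Classical in
/-- A step of the walk. An agent that finds its ID in the log of the node for the preceding step has
not moved in that step. (This is also true in step `0`, as then `τ - 1 = 0`.) -/
noncomputable def walkRule {n : ℕ} (W : ℕ) (τ id : ℕ) (o : ZMod n) (F : Set (ZMod n × ℕ))
    (w : Log (AgentState n)) : AgentState n × Move :=
  let o' := if id ∈ idsAt w (τ - 1) then o else o + 1
  let F' := F ∪ {p | p.1 = o' ∧ p.2 ∈ idsAt w 0}
  (AgentState.walking o' F', if AtTarget W F' then Move.stay else Move.forward)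

open Classical in
/-- The formation of groups after the walk. The agents of a node that holds at least `2 * g` of them
split into a forward group of size `g`, a backward group of size between `g` and `2 * g - 1`, and
possibly at least `g` agents that remain; the groups are called by the smallest ID present. -/
noncomputable def formRule {n : ℕ} (g τ id : ℕ) (w : Log (AgentState n)) : AgentState n :=
  let M := idsAt w τ
  let r := {i ∈ M | i < id}.ncard
  if M.ncard < 2 * g then AgentState.idle
  else if r < g then AgentState.moving true (sInf M)
  else if M.ncard < 3 * g ∨ r < 2 * g then AgentState.moving false (sInf M)
  else AgentState.settled

/-- The IDs of the agents that continue as members of the group `(d, x)` when it meets idle agents: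
its own members, and the idle agents, unless the group is a backward group and a forward group is
present as well. -/
def joining {n : ℕ} (d : Bool) (x : ℕ) (L : Set (ℕ × AgentState n)) : Set ℕ :=
  {i | (i, AgentState.moving d x) ∈ L ∨ (i, AgentState.idle) ∈ L ∧
    (d = true ∨ ∀ j y, (j, AgentState.moving true y) ∉ L)}

open Classical in
/-- The group `(d, x)` together with the idle agents that join it moves on; but if these are at
least `2 * g` agents, then only `g` of them move on and the others settle. -/
noncomputable def joinRule {n : ℕ} (g : ℕ) (d : Bool) (x id : ℕ) (L : Set (ℕ × AgentState n)) :
    AgentState n × Move :=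
  if 2 * g ≤ (joining d x L).ncard ∧ g ≤ {i ∈ joining d x L | i < id}.ncard then
    (AgentState.settled, Move.stay)
  else (AgentState.moving d x, heading d)

open Classical in
/-- The decision rule of the agents. The walk takes the steps before `T₀`, groups are formed in step
`T₀`, and afterwards the groups sweep the ring. A node that held at least `2 * g` agents in step
`T₀` is a base. A group leaves its own base and stays at any other base. -/
noncomputable def gatherRule (g n T₀ : ℕ) : Rule (AgentState n) := fun τ id s w =>
  match s with
  | AgentState.walking o F =>
    if τ < T₀ then walkRule (4 * g - 2) τ id o F w else (formRule g τ id w, Move.stay)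
  | AgentState.idle =>
    if ∃ j y, (j, AgentState.moving true y) ∈ w τ then
      joinRule g true (sInf {y | ∃ j, (j, AgentState.moving true y) ∈ w τ}) id (w τ)
    else if ∃ j y, (j, AgentState.moving false y) ∈ w τ then
      joinRule g false (sInf {y | ∃ j, (j, AgentState.moving false y) ∈ w τ}) id (w τ)
    else (AgentState.idle, Move.stay)
  | AgentState.moving d x =>
    if 2 * g ≤ (idsAt w T₀).ncard then
      (AgentState.moving d x, if sInf (idsAt w T₀) = x then heading d else Move.stay)
    else joinRule g d x id (w τ)
  | AgentState.settled => (AgentState.settled, Move.stay)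

theorem sInf_lt_of_forall {S : Set ℕ} {N : ℕ} (hN : 0 < N) (h : ∀ i ∈ S, i < N) : sInf S < N := by
  rcases S.eq_empty_or_nonempty with rfl | hS
  · simpa using hN
  · exact h _ (Nat.sInf_mem hS)

theorem joinRule_fst {n : ℕ} (g : ℕ) (d : Bool) (x id : ℕ) (L : Set (ℕ × AgentState n)) :
    (joinRule g d x id L).1 = AgentState.settled ∨
      (joinRule g d x id L).1 = AgentState.moving d x := by
  rw [joinRule]
  split_ifs <;> simp

/-- Agents with IDs below `N` only use finitely many states. -/
theorem gatherRule_finite (g n T₀ : ℕ) [NeZero n] (N : ℕ) :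
    ∃ S : Set (AgentState n), S.Finite ∧ AgentState.walking 0 ∅ ∈ S ∧
      ∀ id < N, ∀ s ∈ S, ∀ w : Log (AgentState n), (∀ τ, ∀ p ∈ w τ, p.1 < N ∧ p.2 ∈ S) →
        ∀ τ, (gatherRule g n T₀ τ id s w).1 ∈ S := by
  have hU : ((Set.univ : Set (ZMod n)) ×ˢ Set.Iio N).Finite :=
    (Set.toFinite _).prod (Set.finite_Iio N)
  let S : Set (AgentState n) :=
    (fun p : ZMod n × Set (ZMod n × ℕ) => AgentState.walking p.1 p.2) ''
        (Set.univ ×ˢ {F | F ⊆ Set.univ ×ˢ Set.Iio N}) ∪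
      (fun p : Bool × ℕ => AgentState.moving p.1 p.2) '' (Set.univ ×ˢ Set.Iio N) ∪
      {AgentState.idle, AgentState.settled}
  have hwalk : ∀ o F, AgentState.walking o F ∈ S ↔ ∀ p ∈ F, p.2 < N := by
    intro o F
    constructor
    · rintro ((⟨⟨o', F'⟩, ⟨-, hF⟩, h⟩ | ⟨_, _, h⟩) | h | h)
      · cases h
        exact fun p hp => (hF hp).2
      all_goals cases h
    · exact fun h => Or.inl (Or.inl ⟨(o, F), ⟨trivial, fun p hp => ⟨trivial, h p hp⟩⟩, rfl⟩)
  have hmov : ∀ d x, AgentState.moving d x ∈ S ↔ x < N := by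
    intro d x
    constructor
    · rintro ((⟨_, _, h⟩ | ⟨⟨d', x'⟩, ⟨-, hx⟩, h⟩) | h | h)
      · cases h
      · cases h
        exact hx
      all_goals cases h
    · exact fun h => Or.inl (Or.inr ⟨(d, x), ⟨trivial, h⟩, rfl⟩)
  have hidle : AgentState.idle ∈ S := Or.inr (Or.inl rfl)
  have hset : AgentState.settled ∈ S := Or.inr (Or.inr rfl)
  refine ⟨S, ?_, (hwalk _ _).2 (by simp), fun id hid s hs w hw τ => ?_⟩
  · exact (((Set.toFinite _).prod hU.finite_subsets).image _ |>.union
      (((Set.toFinite _).prod (Set.finite_Iio N)).image _)).union (Set.toFinite _)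
  have hN : 0 < N := by omega
  have hids : ∀ τ, ∀ i ∈ idsAt w τ, i < N := by
    rintro τ i ⟨s, hs⟩
    exact (hw τ _ hs).1
  have hname : ∀ d, sInf {y | ∃ j, (j, AgentState.moving d y) ∈ w τ} < N := by
    refine fun d => sInf_lt_of_forall hN ?_
    rintro y ⟨j, hj⟩
    exact (hmov d y).1 (hw τ _ hj).2
  have hjoin : ∀ d x L, x < N → (joinRule g d x id L).1 ∈ S := by
    intro d x L hx
    rcases joinRule_fst g d x id L with h | h <;> rw [h]
    · exact hset
    · exact (hmov d x).2 hx
  cases s with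
  | walking o F =>
    simp only [gatherRule]
    split_ifs
    · refine (hwalk _ _).2 ?_
      rintro p (hp | hp)
      · exact (hwalk o F).1 hs p hp
      · exact hids _ _ hp.2
    · simp only [formRule]
      split_ifs
      · exact hidle
      · exact (hmov _ _).2 (sInf_lt_of_forall hN (hids τ))
      · exact (hmov _ _).2 (sInf_lt_of_forall hN (hids τ))
      · exact hset
  | idle =>
    simp only [gatherRule]
    split_ifs
    · exact hjoin _ _ _ (hname _)
    · exact hjoin _ _ _ (hname _)
    · exact hidle
  | moving d x =>
    simp only [gatherRule]
    split_ifs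
    · exact hs
    · exact hs
    · exact hjoin _ _ _ ((hmov d x).1 hs)
  | settled => exact hset

/-! ### The walk -/

theorem mem_idsAt_register {σ : Type} {n k : ℕ} (init : σ) (rule : Rule σ) (E : Scenario n k)
    {τ τ' : ℕ} {v : ZMod n} {i : ℕ} :
    i ∈ idsAt ((snapshot init rule E τ).register E.ids τ v) τ' ↔
      τ' ≤ τ ∧ ∃ a, (snapshot init rule E τ').pos a = v ∧ E.ids a = i := by
  simp only [idsAt, Set.mem_ofPred_eq, mem_snapshot_register, Prod.mk.injEq]
  constructor
  · rintro ⟨s, h, a, h1, h2, -⟩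
    exact ⟨h, a, h1, h2⟩
  · rintro ⟨h, a, h1, h2⟩
    exact ⟨_, h, a, h1, h2, rfl⟩

/-- The effect of the steps of the decision rule of the agents. -/
noncomputable abbrev gatherSnapshot {n k : ℕ} (E : Scenario n k) (g T₀ : ℕ) :
    ℕ → Snapshot (AgentState n) n k :=
  snapshot (AgentState.walking 0 ∅) (gatherRule g n T₀) E

section WalkPhase

variable {n k : ℕ} (E : Scenario n k)

/-- The distance in forward direction from the home of `a` to the home of `b`. -/
def homeDist (a b : Fin k) : ℕ := (E.home b - E.home a).val

/-- What an agent has seen when it has walked the distance `s` from its home. -/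
def seen (a : Fin k) (s : ℕ) : Set (ZMod n × ℕ) :=
  (fun b => (E.home b - E.home a, E.ids b)) '' {b | homeDist E a b ≤ s}

/-- The distance that agent `a` has walked after `τ` steps. -/
noncomputable def walked (g : ℕ) (a : Fin k) : ℕ → ℕ :=
  walk (fun i => AtTarget (4 * g - 2) (seen E a i))
    fun τ i => E.missing (2 * τ + 1) = some (E.home a + i)

theorem homeDist_injective [NeZero n] (a : Fin k) : Function.Injective (homeDist E a) :=
  fun _ _ h => E.home_injective (sub_left_injective (ZMod.val_injective n h))

theorem homeDist_eq_iff [NeZero n] (a b : Fin k) {s : ℕ} (hs : s < n) :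
    homeDist E a b = s ↔ E.home b = E.home a + s := by
  rw [homeDist, ← sub_eq_iff_eq_add', ← ZMod.val_natCast_of_lt hs, (ZMod.val_injective n).eq_iff,
    ZMod.val_natCast_of_lt hs]

theorem homeDist_self (a : Fin k) : homeDist E a a = 0 := by simp [homeDist]

theorem atTarget_seen_iff (W : ℕ) (a : Fin k) (s : ℕ) :
    AtTarget W (seen E a s) ↔ ∃ b, homeDist E a b ≤ s ∧
      {c | homeDist E a c < homeDist E a b}.ncard ≤ W ∧
      W ≤ {c | homeDist E a b < homeDist E a c ∧ homeDist E a c ≤ s}.ncard ∧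
      ∀ b', homeDist E a b' ≤ s → {c | homeDist E a c < homeDist E a b'}.ncard ≤ W →
        E.ids b ≤ E.ids b' := by
  let f : Fin k → ZMod n × ℕ := fun b => (E.home b - E.home a, E.ids b)
  have hf : Function.Injective f := fun b c h => E.ids_injective (Prod.ext_iff.1 h).2
  have hcard : ∀ P : ZMod n × ℕ → Prop, {q ∈ seen E a s | P q}.ncard =
      {c | homeDist E a c ≤ s ∧ P (f c)}.ncard := by
    intro P
    rw [← Set.ncard_image_of_injective _ hf]
    congr 1
    ext q
    constructor
    · rintro ⟨⟨c, hc, rfl⟩, hq⟩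
      exact ⟨c, ⟨hc, hq⟩, rfl⟩
    · rintro ⟨c, ⟨hc, hq⟩, rfl⟩
      exact ⟨⟨c, hc, rfl⟩, hq⟩
  have hlt : ∀ b, homeDist E a b ≤ s → {q ∈ seen E a s | q.1.val < (f b).1.val}.ncard =
      {c | homeDist E a c < homeDist E a b}.ncard := by
    intro b hb
    rw [hcard]
    congr 1
    ext c
    exact ⟨fun h => h.2, fun h => ⟨(le_of_lt h).trans hb, h⟩⟩
  have hgt : ∀ b, {q ∈ seen E a s | (f b).1.val < q.1.val}.ncard =
      {c | homeDist E a b < homeDist E a c ∧ homeDist E a c ≤ s}.ncard := by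
    intro b
    rw [hcard]
    congr 1
    ext c
    exact and_comm
  constructor
  · rintro ⟨_, ⟨b, hb, rfl⟩, h1, h2, h3⟩
    refine ⟨b, hb, (hlt b hb).symm.trans_le h1, h2.trans_eq (hgt b), fun b' hb' h => ?_⟩
    exact h3 (f b') ⟨b', hb', rfl⟩ ((hlt b' hb').trans_le h)
  · rintro ⟨b, hb, h1, h2, h3⟩
    refine ⟨f b, ⟨b, hb, rfl⟩, (hlt b hb).trans_le h1, h2.trans_eq (hgt b).symm, ?_⟩
    rintro _ ⟨b', hb', rfl⟩ h
    exact h3 b' hb' ((hlt b' hb').symm.trans_le h)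

/-- A walking agent stops at the latest at the `2 * W`-th home after its own one. -/
theorem atTarget_seen_of_card [NeZero n] {W : ℕ} {a : Fin k} {s : ℕ}
    (h : 2 * W + 1 ≤ {b | homeDist E a b ≤ s}.ncard) : AtTarget W (seen E a s) := by
  rw [atTarget_seen_iff]
  let R : Set (Fin k) := {b | {c | homeDist E a c < homeDist E a b}.ncard ≤ W}
  have ha : a ∈ R := by simp [R, homeDist_self]
  obtain ⟨b, hb, hmin⟩ := Set.exists_min_image R E.ids (Set.toFinite _) ⟨a, ha⟩
  have hbR : {c | homeDist E a c < homeDist E a b}.ncard ≤ W := hb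
  have hbs : homeDist E a b ≤ s := by
    by_contra hlt
    have : {b | homeDist E a b ≤ s}.ncard ≤ {c | homeDist E a c < homeDist E a b}.ncard :=
      Set.ncard_le_ncard (fun c hc => lt_of_le_of_lt hc (not_le.1 hlt)) (Set.toFinite _)
    omega
  refine ⟨b, hbs, hbR, ?_, fun b' _ h' => hmin b' h'⟩
  have hsub : {b | homeDist E a b ≤ s} ⊆ {c | homeDist E a c < homeDist E a b} ∪
      insert b {c | homeDist E a b < homeDist E a c ∧ homeDist E a c ≤ s} := by
    intro c hc
    rcases lt_trichotomy (homeDist E a c) (homeDist E a b) with h' | h' | h'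
    · exact Or.inl h'
    · exact Or.inr (Or.inl (homeDist_injective E a h'))
    · exact Or.inr (Or.inr ⟨h', hc⟩)
  have h1 := (Set.ncard_le_ncard hsub (Set.toFinite _)).trans (Set.ncard_union_le _ _)
  have h2 := Set.ncard_insert_le b {c | homeDist E a b < homeDist E a c ∧ homeDist E a c ≤ s}
  omega

theorem walked_lt [NeZero n] {g : ℕ} (hg : 1 ≤ g) (hk : 8 * g - 3 ≤ k) (a : Fin k) (τ : ℕ) :
    walked E g a τ < n := by
  have hn : 0 < n := Nat.pos_of_neZero n
  by_contra h
  refine not_goal_of_lt_walk (i := n - 1) (show n - 1 < walked E g a τ by omega)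
    (atTarget_seen_of_card E ?_)
  have huniv : {b | homeDist E a b ≤ n - 1} = Set.univ :=
    Set.eq_univ_of_forall fun b => Nat.le_sub_one_of_lt (ZMod.val_lt _)
  rw [huniv, Set.ncard_univ, Nat.card_fin]
  omega

theorem seen_union [NeZero n] (a : Fin k) {s : ℕ} (hs : s < n) (F : Set (ZMod n × ℕ))
    (hF : F ⊆ seen E a s) (hF' : ∀ b, homeDist E a b < s → (E.home b - E.home a, E.ids b) ∈ F) :
    F ∪ {p | p.1 = (s : ZMod n) ∧ ∃ b, E.home b = E.home a + s ∧ E.ids b = p.2} = seen E a s := by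
  ext p
  constructor
  · rintro (hp | ⟨h1, b, h2, h3⟩)
    · exact hF hp
    · refine ⟨b, ((homeDist_eq_iff E a b hs).2 h2).le, Prod.ext ?_ h3⟩
      simp [h1, h2]
  · rintro ⟨b, hb, rfl⟩
    rcases Nat.lt_or_eq_of_le (show homeDist E a b ≤ s from hb) with h | h
    · exact Or.inl (hF' b h)
    · have h2 := (homeDist_eq_iff E a b hs).1 h
      exact Or.inr ⟨by simp [h2], b, h2, rfl⟩

theorem natCast_injOn [NeZero n] {s t : ℕ} (hs : s < n) (ht : t < n)
    (h : (s : ZMod n) = (t : ZMod n)) : s = t := by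
  rw [← ZMod.val_natCast_of_lt hs, h, ZMod.val_natCast_of_lt ht]

/-- The configuration during the walk. -/
theorem snapshot_walk [NeZero n] {g T₀ : ℕ} (hg : 1 ≤ g) (hk : 8 * g - 3 ≤ k) {τ : ℕ}
    (hτ : τ ≤ T₀) (a : Fin k) :
    (gatherSnapshot E g T₀ τ).pos a =
      E.home a + (walked E g a τ : ℕ) ∧
    (gatherSnapshot E g T₀ τ).state a =
      AgentState.walking ((walked E g a (τ - 1) : ℕ) : ZMod n)
        (if τ = 0 then ∅ else seen E a (walked E g a (τ - 1))) := by
  classical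
  induction τ using Nat.strong_induction_on generalizing a with
  | _ τ ih =>
  cases τ with
  | zero => simp [snapshot, walked, walk]
  | succ τ =>
    obtain ⟨hpos, hstate⟩ := ih τ (by omega) (by omega) a
    obtain ⟨hpos', -⟩ := ih (τ - 1) (by omega) (by omega) a
    have hlt := walked_lt E hg hk a
    set m := gatherSnapshot E g T₀ τ with hm
    set w := m.register E.ids τ (m.pos a) with hw
    have hstay : E.ids a ∈ idsAt w (τ - 1) ↔ walked E g a (τ - 1) = walked E g a τ := by
      rw [hw, hm, mem_idsAt_register, ← hm]
      constructor
      · rintro ⟨-, b, hb, hba⟩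
        obtain rfl := E.ids_injective hba
        rw [hpos', hpos, add_right_inj] at hb
        exact natCast_injOn (hlt _) (hlt _) hb
      · intro h
        exact ⟨by omega, a, by rw [hpos', hpos, h], rfl⟩
    have hstep : walked E g a τ = walked E g a (τ - 1) ∨
        walked E g a τ = walked E g a (τ - 1) + 1 := by
      rcases τ with _ | τ
      · exact Or.inl rfl
      · exact walk_succ_eq_or τ
    have ho : (if E.ids a ∈ idsAt w (τ - 1) then ((walked E g a (τ - 1) : ℕ) : ZMod n)
        else ((walked E g a (τ - 1) : ℕ) : ZMod n) + 1) = ((walked E g a τ : ℕ) : ZMod n) := by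
      split_ifs with h
      · rw [hstay.1 h]
      · rw [hstay] at h
        have : walked E g a τ = walked E g a (τ - 1) + 1 := by omega
        rw [this]
        push_cast
        rfl
    have hhome : idsAt w 0 = {i | ∃ b, E.home b = E.home a + (walked E g a τ : ℕ) ∧ E.ids b = i} := by
      ext i
      rw [hw, hm, mem_idsAt_register, ← hm, hpos]
      simp [snapshot]
    have hseen := seen_union E a (hlt τ) (if τ = 0 then ∅ else seen E a (walked E g a (τ - 1)))
      (by
        split_ifs
        · exact Set.empty_subset _
        · exact Set.image_mono fun b (hb : homeDist E a b ≤ walked E g a (τ - 1)) =>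
            show homeDist E a b ≤ walked E g a τ by omega)
      (by
        intro b hb
        split_ifs with h0
        · subst h0
          simp [walked, walk] at hb
        · exact ⟨b, show homeDist E a b ≤ _ by omega, rfl⟩)
    have hrule : gatherRule g n T₀ τ (E.ids a) (m.state a) w =
        (AgentState.walking ((walked E g a τ : ℕ) : ZMod n) (seen E a (walked E g a τ)),
          if AtTarget (4 * g - 2) (seen E a (walked E g a τ)) then Move.stay else Move.forward) := by
      rw [hstate]
      simp only [gatherRule, if_pos (show τ < T₀ by omega), walkRule, ho, hhome]
      simp only [Set.mem_ofPred_eq, hseen]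
    have hnext : gatherSnapshot E g T₀ (τ + 1) =
      ⟨fun b => (gatherRule g n T₀ τ (E.ids b) (m.state b) (m.register E.ids τ (m.pos b))).1,
        fun b => dest (E.missing (2 * τ + 1)) (m.pos b)
          (gatherRule g n T₀ τ (E.ids b) (m.state b) (m.register E.ids τ (m.pos b))).2,
        m.register E.ids τ⟩ := rfl
    rw [hnext]
    simp only
    rw [← hw, hrule]
    refine ⟨?_, by simp⟩
    by_cases hs : AtTarget (4 * g - 2) (seen E a (walked E g a τ))
    · rw [if_pos hs, walked, walk_succ_of_or (Or.inl hs)]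
      exact hpos
    · rw [if_neg hs]
      simp only [dest]
      by_cases hb : E.missing (2 * τ + 1) = some (m.pos a)
      · rw [if_pos hb, hpos]
        rw [hpos] at hb
        rw [walked, walk_succ_of_or (Or.inr hb)]
      · rw [if_neg hb, hpos]
        rw [hpos] at hb
        rw [walked, walk_succ_of_not hs hb]
        push_cast
        rw [add_assoc]

end WalkPhase

section WalkResult

variable {n k : ℕ} (E : Scenario n k)

theorem home_eq_add [NeZero n] (a b : Fin k) :
    E.home b = E.home a + (homeDist E a b : ℕ) :=
  (homeDist_eq_iff E a b (ZMod.val_lt _)).1 rfl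

theorem val_sub_le_of_le [NeZero n] {x y z : ZMod n} (h : (y - x).val ≤ (z - x).val) :
    (z - y).val ≤ (z - x).val := by
  have h1 : z - y = (z - x) - (y - x) := by ring
  rw [h1, ZMod.val_sub h]
  exact Nat.sub_le _ _

/-- Two agents that are still walking after `2 * n` steps have been blocked simultaneously, hence at
the same node, and have moved together since then. -/
theorem add_walked_eq_of_not_atTarget [NeZero n] {g : ℕ} (hg : 1 ≤ g) (hk : 8 * g - 3 ≤ k)
    {a b : Fin k} (ha : ¬ AtTarget (4 * g - 2) (seen E a (walked E g a (2 * n))))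
    (hb : ¬ AtTarget (4 * g - 2) (seen E b (walked E g b (2 * n)))) :
    E.home a + (walked E g a (2 * n) : ℕ) = E.home b + (walked E g b (2 * n) : ℕ) := by
  have hns : ∀ {a : Fin k}, ¬ AtTarget (4 * g - 2) (seen E a (walked E g a (2 * n))) →
      ∀ u ≤ 2 * n, ¬ AtTarget (4 * g - 2) (seen E a (walked E g a u)) := by
    intro a ha u hu
    have hle : walked E g a u ≤ walked E g a (2 * n) := walk_mono hu
    rcases Nat.lt_or_eq_of_le hle with h | h
    · exact not_goal_of_lt_walk h
    · rwa [h]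
  have h1 := walked_lt E hg hk a (2 * n)
  have h2 := walked_lt E hg hk b (2 * n)
  obtain ⟨t, ht, hta, htb⟩ := exists_both_blocked ha hb
    (show walked E g a (2 * n) + walked E g b (2 * n) < 2 * n by omega)
  have hmeet : E.home a + (walked E g a t : ℕ) = E.home b + (walked E g b t : ℕ) :=
    Option.some_injective _ (hta.symm.trans htb)
  have key : ∀ u, t ≤ u → u ≤ 2 * n →
      E.home a + (walked E g a u : ℕ) = E.home b + (walked E g b u : ℕ) := by
    intro u hu
    induction u, hu using Nat.le_induction with
    | base => exact fun _ => hmeet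
    | succ u _ ih =>
      intro hu'
      have ih := ih (by omega)
      by_cases hbl : E.missing (2 * u + 1) = some (E.home a + (walked E g a u : ℕ))
      · have hbl' := hbl
        rw [ih] at hbl'
        rw [show walked E g a (u + 1) = walked E g a u from walk_succ_of_or (Or.inr hbl),
          show walked E g b (u + 1) = walked E g b u from walk_succ_of_or (Or.inr hbl'), ih]
      · have hbl' := hbl
        rw [ih] at hbl'
        rw [show walked E g a (u + 1) = walked E g a u + 1 from
            walk_succ_of_not (hns ha u (by omega)) hbl,
          show walked E g b (u + 1) = walked E g b u + 1 from
            walk_succ_of_not (hns hb u (by omega)) hbl']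
        push_cast
        rw [← add_assoc, ← add_assoc, ih]
  exact key _ ht.le le_rfl

/-- If the agent with the smallest ID lives at one of the first `W + 1` homes that `a` sees, then
`a` stops as soon as it is `W` homes beyond. -/
theorem atTarget_iff_of_min [NeZero n] {W : ℕ} {a c : Fin k} (hc : ∀ b, E.ids c ≤ E.ids b)
    (hac : {b | homeDist E a b < homeDist E a c}.ncard ≤ W) (s : ℕ) :
    AtTarget W (seen E a s) ↔ homeDist E a c ≤ s ∧
      W ≤ {b | homeDist E a c < homeDist E a b ∧ homeDist E a b ≤ s}.ncard := by
  rw [atTarget_seen_iff]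
  constructor
  · rintro ⟨b, hb, -, h2, h3⟩
    have hcs : homeDist E a c ≤ s := by
      by_contra hlt
      have hsub : insert b {c | homeDist E a b < homeDist E a c ∧ homeDist E a c ≤ s} ⊆
          {b | homeDist E a b < homeDist E a c} := by
        rintro d (rfl | hd)
        · exact lt_of_le_of_lt hb (not_le.1 hlt)
        · exact lt_of_le_of_lt hd.2 (not_le.1 hlt)
      have h4 := Set.ncard_le_ncard hsub (Set.toFinite _)
      rw [Set.ncard_insert_of_notMem (fun h => lt_irrefl _ h.1) (Set.toFinite _)] at h4
      omega
    obtain rfl : b = c := E.ids_injective (le_antisymm (h3 c hcs hac) (hc b))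
    exact ⟨hcs, h2⟩
  · rintro ⟨h1, h2⟩
    exact ⟨c, h1, hac, h2, fun b _ _ => hc b⟩

theorem setOf_homeDist_between [NeZero n] (a c : Fin k) {s : ℕ} (hs : s < n)
    (hcs : homeDist E a c ≤ s) :
    {b | homeDist E a c < homeDist E a b ∧ homeDist E a b ≤ s} =
      {b | 0 < homeDist E c b ∧ homeDist E c b ≤ s - homeDist E a c} := by
  ext b
  have hc := home_eq_add E a c
  constructor
  · rintro ⟨h1, h2⟩
    have h3 : homeDist E c b = homeDist E a b - homeDist E a c := by
      rw [homeDist_eq_iff E c b (by omega), hc, home_eq_add E a b, Nat.cast_sub h1.le]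
      ring
    exact ⟨by omega, by omega⟩
  · rintro ⟨h1, h2⟩
    have h3 : homeDist E a b = homeDist E a c + homeDist E c b := by
      rw [homeDist_eq_iff E a b (by omega), home_eq_add E c b, hc]
      push_cast
      ring
    exact ⟨by omega, by omega⟩

theorem homeDist_injective_left [NeZero n] (c : Fin k) :
    Function.Injective fun b => homeDist E b c :=
  fun _ _ h => E.home_injective (sub_right_injective (ZMod.val_injective n h))

/-- After `2 * n` steps of the walk, some node holds at least `2 * g` agents: either the agents that
are still walking do, or at least `2 * g` of the `4 * g - 1` agents that are attracted by the
smallest ID have arrived. -/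
theorem exists_base [NeZero n] {g : ℕ} (hg : 1 ≤ g) (hk : 8 * g - 3 ≤ k) :
    ∃ v : ZMod n, 2 * g ≤ {a | E.home a + (walked E g a (2 * n) : ℕ) = v}.ncard := by
  set W := 4 * g - 2 with hW
  let U : Set (Fin k) := {a | ¬ AtTarget W (seen E a (walked E g a (2 * n)))}
  by_cases hU : 2 * g ≤ U.ncard
  · obtain ⟨a, ha⟩ := Set.nonempty_of_ncard_ne_zero (s := U) (by omega)
    refine ⟨E.home a + (walked E g a (2 * n) : ℕ), hU.trans ?_⟩
    exact Set.ncard_le_ncard (fun b hb => add_walked_eq_of_not_atTarget E hg hk hb ha)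
      (Set.toFinite _)
  · have : Nonempty (Fin k) := ⟨⟨0, by omega⟩⟩
    obtain ⟨c, hc⟩ := Finite.exists_min E.ids
    let R : Set (Fin k) := {a | {b | homeDist E a b < homeDist E a c}.ncard ≤ W}
    have hR : W + 1 ≤ R.ncard := by
      have h1 := ncard_rank_lt (homeDist_injective_left E c) Set.univ (W + 1)
      rw [Set.ncard_univ, Nat.card_fin, min_eq_left (by omega)] at h1
      rw [← h1]
      refine Set.ncard_le_ncard (fun a ha => ?_) (Set.toFinite _)
      have ha' : {b | homeDist E b c < homeDist E a c}.ncard < W + 1 := by simpa using ha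
      -- the homes from `a` up to `c`, without `c` or without `a`, are counted on the two sides
      have hsub : insert c {b | homeDist E a b < homeDist E a c} ⊆
          insert a {b | homeDist E b c < homeDist E a c} := by
        have h2 : ∀ b, homeDist E a b ≤ homeDist E a c →
            b ∈ insert a {b | homeDist E b c < homeDist E a c} := by
          intro b hb
          rcases Nat.lt_or_eq_of_le (val_sub_le_of_le hb) with h | h
          · exact Or.inr h
          · exact Or.inl (homeDist_injective_left E c h)
        rintro b (rfl | hb)
        · exact h2 b le_rfl
        · exact h2 b (le_of_lt hb)
      have h3 := (Set.ncard_le_ncard hsub (Set.toFinite _)).trans (Set.ncard_insert_le _ _)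
      rw [Set.ncard_insert_of_notMem (show c ∉ {b | homeDist E a b < homeDist E a c} from
        fun h => lt_irrefl (homeDist E a c) h) (Set.toFinite _)] at h3
      change _ ≤ W
      omega
    have hdiff := Set.ncard_le_ncard_sdiff_add_ncard R U (Set.toFinite _)
    obtain ⟨a, ha⟩ := Set.nonempty_of_ncard_ne_zero (s := R \ U) (by omega)
    refine ⟨E.home a + (walked E g a (2 * n) : ℕ), (show 2 * g ≤ (R \ U).ncard by omega).trans
      (Set.ncard_le_ncard (fun b hb => ?_) (Set.toFinite _))⟩
    -- all of them have covered, beyond the home of `c`, the least distance with `W` homes on it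
    have key : ∀ a ∈ R \ U, ∃ e : ℕ, E.home a + (walked E g a (2 * n) : ℕ) = E.home c + (e : ℕ) ∧
        W ≤ {b | 0 < homeDist E c b ∧ homeDist E c b ≤ e}.ncard ∧
        ∀ e' < e, {b | 0 < homeDist E c b ∧ homeDist E c b ≤ e'}.ncard < W := by
      rintro a ⟨haR, haU⟩
      have hlt := walked_lt E hg hk a (2 * n)
      have hat := (atTarget_iff_of_min E hc haR _).1 (not_not.1 haU)
      refine ⟨walked E g a (2 * n) - homeDist E a c, ?_, ?_, fun e' he' => ?_⟩
      · rw [home_eq_add E a c, add_assoc, ← Nat.cast_add, Nat.add_sub_cancel' hat.1]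
      · rw [← setOf_homeDist_between E a c hlt hat.1]
        exact hat.2
      · by_contra hge
        refine not_goal_of_lt_walk (show homeDist E a c + e' < walked E g a (2 * n) by omega)
          ((atTarget_iff_of_min E hc haR _).2 ⟨by omega, ?_⟩)
        rw [setOf_homeDist_between E a c (by omega) (by omega), Nat.add_sub_cancel_left]
        omega
    obtain ⟨e, h1, h2, h3⟩ := key a ha
    obtain ⟨e', h1', h2', h3'⟩ := key b hb
    have he : e = e' := by
      rcases lt_trichotomy e e' with h | h | h
      · exact absurd h2 (not_le.2 (h3' e h))
      · exact h
      · exact absurd h2' (not_le.2 (h3 e' h))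
    change _ = _
    rw [h1, h1', he]

/-- Each link is passed by at most `8 * g` walking agents, as these come from the last `8 * g` homes
before the link. -/
theorem sum_walked_le [NeZero n] {g : ℕ} (hg : 1 ≤ g) (hk : 8 * g - 3 ≤ k) (T : ℕ) :
    ∑ a, walked E g a T ≤ 8 * g * n := by
  classical
  have hcard : ∀ a, walked E g a T =
      (Finset.univ.filter fun v : ZMod n => (v - E.home a).val < walked E g a T).card := by
    intro a
    have hlt := walked_lt E hg hk a T
    conv_lhs => rw [← Finset.card_range (walked E g a T)]
    refine Finset.card_bij (fun i _ => E.home a + (i : ZMod n)) ?_ ?_ ?_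
    · intro i hi
      have hi := Finset.mem_range.1 hi
      simp [ZMod.val_natCast_of_lt (hi.trans hlt), hi]
    · intro i hi j hj h
      exact natCast_injOn ((Finset.mem_range.1 hi).trans hlt) ((Finset.mem_range.1 hj).trans hlt)
        (add_left_cancel h)
    · intro v hv
      exact ⟨(v - E.home a).val, Finset.mem_range.2 (Finset.mem_filter.1 hv).2, by simp⟩
  rw [Finset.sum_congr rfl fun a _ => hcard a]
  simp only [Finset.card_filter]
  rw [Finset.sum_comm]
  simp only [← Finset.card_filter]
  have hv : ∀ v : ZMod n,
      (Finset.univ.filter fun a => (v - E.home a).val < walked E g a T).card ≤ 8 * g := by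
    intro v
    have hinj : Function.Injective fun b => (v - E.home b).val :=
      fun _ _ h => E.home_injective (sub_right_injective (ZMod.val_injective n h))
    have h1 := ncard_rank_lt hinj Set.univ (8 * g)
    rw [← Set.ncard_coe_finset]
    refine (Set.ncard_le_ncard (fun a ha => ?_) (Set.toFinite _)).trans
      (h1.le.trans (min_le_left _ _))
    have ha : (v - E.home a).val < walked E g a T := by simpa using ha
    refine ⟨trivial, ?_⟩
    by_contra hge
    refine not_goal_of_lt_walk ha (atTarget_seen_of_card E ?_)
    refine le_trans ?_ (Set.ncard_le_ncard
      (s := {b ∈ Set.univ | (v - E.home b).val < (v - E.home a).val})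
      (fun b hb => ?_) (Set.toFinite _))
    · omega
    · have h2 : (v - E.home b).val < (v - E.home a).val := hb.2
      have h3 : E.home b - E.home a = (v - E.home a) - (v - E.home b) := by ring
      change (E.home b - E.home a).val ≤ _
      rw [h3, ZMod.val_sub h2.le]
      exact Nat.sub_le _ _
  calc _ ≤ ∑ _v : ZMod n, 8 * g := Finset.sum_le_sum fun v _ => hv v
    _ = 8 * g * n := by simp [ZMod.card, mul_comm]

theorem sum_moves_walk [NeZero n] {g T₀ : ℕ} (hg : 1 ≤ g) (hk : 8 * g - 3 ≤ k) :
    ∑ i ∈ Finset.range T₀, (Finset.univ.filter fun a =>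
      (gatherSnapshot E g T₀ (i + 1)).pos a ≠ (gatherSnapshot E g T₀ i).pos a).card ≤ 8 * g * n := by
  refine le_trans ?_ (sum_walked_le E hg hk T₀)
  have h : ∀ T ≤ T₀, ∑ i ∈ Finset.range T, (Finset.univ.filter fun a =>
      (gatherSnapshot E g T₀ (i + 1)).pos a ≠ (gatherSnapshot E g T₀ i).pos a).card ≤
      ∑ a, walked E g a T := by
    intro T hT
    induction T with
    | zero => simp
    | succ T ih =>
      rw [Finset.sum_range_succ]
      have h1 : ∀ a, walked E g a T +
          (if (gatherSnapshot E g T₀ (T + 1)).pos a ≠ (gatherSnapshot E g T₀ T).pos a then 1 else 0) ≤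
          walked E g a (T + 1) := by
        intro a
        rw [(snapshot_walk E hg hk hT a).1, (snapshot_walk E hg hk (by omega : T ≤ T₀) a).1]
        have : walked E g a T ≤ walked E g a (T + 1) := walk_mono (Nat.le_succ T)
        split_ifs with h
        · have : walked E g a (T + 1) ≠ walked E g a T := fun h' => h (by rw [h'])
          omega
        · omega
      rw [Finset.card_filter]
      refine (Nat.add_le_add_right (ih (by omega)) _).trans ?_
      rw [← Finset.sum_add_distrib]
      exact Finset.sum_le_sum fun a _ => h1 a
  exact h T₀ le_rfl

end WalkResult

/-! ### The trajectories of the groups -/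

section Trajectories

variable {n k : ℕ} (E : Scenario n k) (g T₀ : ℕ)

/-- The agents at the node `v` in step `T₀`. -/
def heldBy (v : ZMod n) : Set (Fin k) := {a | (gatherSnapshot E g T₀ T₀).pos a = v}

/-- A base is a node that holds at least `2 * g` agents in step `T₀`. -/
def IsBase (v : ZMod n) : Prop := 2 * g ≤ (heldBy E g T₀ v).ncard

/-- The name of the groups that start at the base `v`. -/
noncomputable def baseName (v : ZMod n) : ℕ := sInf (E.ids '' heldBy E g T₀ v)

variable {E g T₀} in
theorem baseName_injOn (hg : 1 ≤ g) {b b' : ZMod n} (hb : IsBase E g T₀ b)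
    (hb' : IsBase E g T₀ b') (h : baseName E g T₀ b = baseName E g T₀ b') : b = b' := by
  have key : ∀ {b}, IsBase E g T₀ b → ∃ a, (gatherSnapshot E g T₀ T₀).pos a = b ∧
      E.ids a = baseName E g T₀ b := by
    intro b hb
    have hne : (heldBy E g T₀ b).Nonempty :=
      Set.nonempty_of_ncard_ne_zero (by rw [IsBase] at hb; omega)
    exact Nat.sInf_mem (hne.image E.ids)
  obtain ⟨a, ha, h1⟩ := key hb
  obtain ⟨a', ha', h2⟩ := key hb'
  obtain rfl := E.ids_injective (h1.trans (h.trans h2.symm))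
  exact ha.symm.trans ha'

/-- The displacement caused by one step in the direction `d`. -/
def unit (n : ℕ) (d : Bool) : ZMod n := if d then 1 else -1

theorem dest_heading_eq_or (missing : Option (ZMod n)) (v : ZMod n) (d : Bool) :
    dest missing v (heading d) = v ∨ dest missing v (heading d) = v + unit n d := by
  cases d <;> simp only [heading, dest, unit] <;> split_ifs <;> simp_all [sub_eq_add_neg]

theorem unit_mul_eq_zero [NeZero n] {d : Bool} {i : ℕ} (hi : i < n) (h : unit n d * i = 0) :
    i = 0 := by
  have h1 : ((i : ℕ) : ZMod n) = ((0 : ℕ) : ZMod n) := by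
    cases d <;> simpa [unit] using h
  exact natCast_injOn hi (Nat.pos_of_neZero n) h1

/-- The distance of the group with direction `d` from its base `b` after `j` steps of the sweep. The
group stops at the next base. -/
noncomputable def swept (b : ZMod n) (d : Bool) : ℕ → ℕ :=
  walk (fun i => IsBase E g T₀ (b + unit n d * i) ∧ b + unit n d * i ≠ b)
    fun j i => dest (E.missing (2 * (T₀ + 1 + j) + 1)) (b + unit n d * i) (heading d) =
      b + unit n d * i

/-- The node of the group with direction `d` from the base `b` after `j` steps of the sweep. -/
noncomputable def groupPos (b : ZMod n) (d : Bool) (j : ℕ) : ZMod n :=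
  b + unit n d * swept E g T₀ b d j

theorem groupPos_zero (b : ZMod n) (d : Bool) : groupPos E g T₀ b d 0 = b := by
  simp [groupPos, swept, walk]

theorem groupPos_succ_of_base {b : ZMod n} {d : Bool} {j : ℕ}
    (h : IsBase E g T₀ (groupPos E g T₀ b d j)) (hne : groupPos E g T₀ b d j ≠ b) :
    groupPos E g T₀ b d (j + 1) = groupPos E g T₀ b d j := by
  rw [groupPos, groupPos,
    show swept E g T₀ b d (j + 1) = swept E g T₀ b d j from walk_succ_of_or (Or.inl ⟨h, hne⟩)]

theorem groupPos_succ {b : ZMod n} {d : Bool} {j : ℕ}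
    (h : ¬ (IsBase E g T₀ (groupPos E g T₀ b d j) ∧ groupPos E g T₀ b d j ≠ b)) :
    groupPos E g T₀ b d (j + 1) =
      dest (E.missing (2 * (T₀ + 1 + j) + 1)) (groupPos E g T₀ b d j) (heading d) := by
  by_cases hb : dest (E.missing (2 * (T₀ + 1 + j) + 1)) (groupPos E g T₀ b d j) (heading d) =
      groupPos E g T₀ b d j
  · rw [hb, groupPos, groupPos,
      show swept E g T₀ b d (j + 1) = swept E g T₀ b d j from walk_succ_of_or (Or.inr hb)]
  · rw [(dest_heading_eq_or _ _ _).resolve_left hb, groupPos, groupPos,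
      show swept E g T₀ b d (j + 1) = swept E g T₀ b d j + 1 from walk_succ_of_not h hb]
    push_cast
    ring

theorem swept_le (b : ZMod n) (d : Bool) (j : ℕ) : swept E g T₀ b d j ≤ j := walk_le j

theorem swept_succ_of_ne {b : ZMod n} {d : Bool} {j : ℕ}
    (h : groupPos E g T₀ b d (j + 1) ≠ groupPos E g T₀ b d j) :
    swept E g T₀ b d (j + 1) = swept E g T₀ b d j + 1 := by
  refine (walk_succ_eq_or j).resolve_left fun h' => h ?_
  rw [groupPos, groupPos, show swept E g T₀ b d (j + 1) = swept E g T₀ b d j from h']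

variable {E g T₀}

/-- If the groups of two bases with the same direction reach a common node, both strictly before
they have passed another base, then the bases agree. -/
theorem base_unique [NeZero n] {d : Bool} {b b' : ZMod n} (hb : IsBase E g T₀ b)
    (hb' : IsBase E g T₀ b') {s s' : ℕ} (hs : s < n) (hs' : s' < n)
    (hpass : ∀ i ≤ s, IsBase E g T₀ (b + unit n d * i) → b + unit n d * i = b)
    (hpass' : ∀ i ≤ s', IsBase E g T₀ (b' + unit n d * i) → b' + unit n d * i = b')
    (h : b + unit n d * s = b' + unit n d * s') : b = b' ∧ s = s' := by
  wlog hle : s ≤ s' generalizing b b' s s'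
  · obtain ⟨h1, h2⟩ := this hb' hb hs' hs hpass' hpass h.symm (by omega)
    exact ⟨h1.symm, h2.symm⟩
  have h1 : b = b' + unit n d * (s' - s : ℕ) := by
    rw [Nat.cast_sub hle]
    linear_combination h
  have h2 := hpass' (s' - s) (by omega) (h1 ▸ hb)
  have h3 : s' - s = 0 := unit_mul_eq_zero (n := n) (d := d) (by omega) (by simpa using h2)
  exact ⟨h1.trans h2, by omega⟩

theorem not_passed_base {b : ZMod n} {d : Bool} {j i : ℕ} (hi : i < swept E g T₀ b d j)
    (h : IsBase E g T₀ (b + unit n d * i)) : b + unit n d * i = b := by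
  by_contra hne
  exact not_goal_of_lt_walk hi ⟨h, hne⟩

/-- Groups of different bases with the same direction do not meet outside the bases. -/
theorem groupPos_inj [NeZero n] {d : Bool} {b b' : ZMod n} {j : ℕ} (hj : j < n)
    (hb : IsBase E g T₀ b) (hb' : IsBase E g T₀ b')
    (hnb : ¬ IsBase E g T₀ (groupPos E g T₀ b d j))
    (h : groupPos E g T₀ b d j = groupPos E g T₀ b' d j) : b = b' := by
  refine (base_unique hb hb' ((swept_le E g T₀ b d j).trans_lt hj)
    ((swept_le E g T₀ b' d j).trans_lt hj) ?_ ?_ h).1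
  · intro i hi hbase
    rcases Nat.lt_or_eq_of_le hi with hlt | rfl
    · exact not_passed_base hlt hbase
    · exact absurd hbase hnb
  · intro i hi hbase
    rcases Nat.lt_or_eq_of_le hi with hlt | rfl
    · exact not_passed_base hlt hbase
    · rw [h] at hnb
      exact absurd hbase hnb

open Classical in
/-- The groups of each direction sweep every link at most once. -/
theorem sum_swept_le [NeZero n] (d : Bool) :
    ∑ b ∈ Finset.univ.filter (IsBase E g T₀), swept E g T₀ b d n ≤ n := by
  have h1 : ((Finset.univ.filter (IsBase E g T₀)).sigma
      fun b => Finset.range (swept E g T₀ b d n)).card ≤ (Finset.univ : Finset (ZMod n)).card := by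
    refine Finset.card_le_card_of_injOn (fun p => p.1 + unit n d * (p.2 : ℕ))
      (fun _ _ => Finset.mem_coe.2 (Finset.mem_univ _)) ?_
    rintro ⟨b, i⟩ hi ⟨b', i'⟩ hi' h
    simp only [Finset.coe_sigma, Set.mem_sigma_iff, Finset.mem_coe, Finset.mem_filter,
      Finset.mem_univ, true_and, Finset.mem_range] at hi hi'
    have h2 := swept_le E g T₀ b d n
    have h3 := swept_le E g T₀ b' d n
    obtain ⟨rfl, rfl⟩ := base_unique (s := i) (s' := i') hi.1 hi'.1 (by omega) (by omega)
      (fun j hj => not_passed_base (lt_of_le_of_lt hj hi.2))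
      (fun j hj => not_passed_base (lt_of_le_of_lt hj hi'.2)) h
    rfl
  rw [Finset.card_sigma, Finset.card_univ, ZMod.card] at h1
  simpa using h1

/-- Every node is visited during the first `n - 1` steps of the sweep: otherwise the forward group
of the last base before it and the backward group of the next base after it would have been blocked
simultaneously, which is only possible at the two ends of the missing link. -/
theorem exists_groupPos_eq (hn : 2 ≤ n) [NeZero n] {v b₀ : ZMod n} (hv : ¬ IsBase E g T₀ v)
    (hb₀ : IsBase E g T₀ b₀) : ∃ b d, ∃ j < n, IsBase E g T₀ b ∧ groupPos E g T₀ b d j = v := by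
  have hadd : ∃ i : ℕ, IsBase E g T₀ (v + i) := ⟨(b₀ - v).val, by simpa using hb₀⟩
  have hsub : ∃ i : ℕ, IsBase E g T₀ (v - i) := ⟨(v - b₀).val, by simpa using hb₀⟩
  classical
  -- the next base is `v + i₂`, and the last one is `v - i₁`; possibly they are the same node
  obtain ⟨i₂, hi₂, hmin₂⟩ : ∃ i₂ : ℕ, IsBase E g T₀ (v + i₂) ∧
      ∀ i < i₂, ¬ IsBase E g T₀ (v + i) :=
    ⟨Nat.find hadd, Nat.find_spec hadd, fun i hi => Nat.find_min hadd hi⟩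
  obtain ⟨i₁, hi₁, hmin₁⟩ : ∃ i₁ : ℕ, IsBase E g T₀ (v - i₁) ∧
      ∀ i < i₁, ¬ IsBase E g T₀ (v - i) :=
    ⟨Nat.find hsub, Nat.find_spec hsub, fun i hi => Nat.find_min hsub hi⟩
  have hle₂ : i₂ ≤ (b₀ - v).val := by
    by_contra h
    exact hmin₂ _ (not_le.1 h) (by simpa using hb₀)
  have hle₁ : i₁ ≤ n - (b₀ - v).val := by
    by_contra h
    refine hmin₁ _ (not_le.1 h) ?_
    rw [Nat.cast_sub (ZMod.val_lt _).le]
    simpa using hb₀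
  have hpos₂ : 0 < i₂ := Nat.pos_of_ne_zero fun h => hv (by simpa [h] using hi₂)
  have hpos₁ : 0 < i₁ := Nat.pos_of_ne_zero fun h => hv (by simpa [h] using hi₁)
  have hval := ZMod.val_lt (b₀ - v)
  by_contra! hne
  have hs₁ : swept E g T₀ (v - i₁) true (n - 1) < i₁ := by
    by_contra h
    obtain ⟨u, hu, hw⟩ := exists_walk_eq (not_lt.1 h)
    refine hne (v - i₁) true u (by omega) hi₁ ?_
    rw [groupPos, show swept E g T₀ (v - i₁) true u = i₁ from hw]
    simp [unit]
  have hs₂ : swept E g T₀ (v + i₂) false (n - 1) < i₂ := by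
    by_contra h
    obtain ⟨u, hu, hw⟩ := exists_walk_eq (not_lt.1 h)
    refine hne (v + i₂) false u (by omega) hi₂ ?_
    rw [groupPos, show swept E g T₀ (v + i₂) false u = i₂ from hw]
    simp [unit]
  have hns₁ : ∀ i < i₁, ¬ (IsBase E g T₀ (v - i₁ + unit n true * i) ∧
      v - i₁ + unit n true * i ≠ v - i₁) := by
    rintro i hi ⟨h1, h2⟩
    rcases Nat.eq_zero_or_pos i with rfl | hi0
    · simp at h2
    · refine hmin₁ (i₁ - i) (by omega) ?_
      rw [Nat.cast_sub hi.le]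
      convert h1 using 1
      simp only [unit, if_true]
      ring
  have hns₂ : ∀ i < i₂, ¬ (IsBase E g T₀ (v + i₂ + unit n false * i) ∧
      v + i₂ + unit n false * i ≠ v + i₂) := by
    rintro i hi ⟨h1, h2⟩
    rcases Nat.eq_zero_or_pos i with rfl | hi0
    · simp at h2
    · refine hmin₂ (i₂ - i) (by omega) ?_
      rw [Nat.cast_sub hi.le]
      convert h1 using 1
      simp [unit]
      ring
  obtain ⟨t, ht, h1, h2⟩ := exists_both_blocked (hns₁ _ hs₁) (hns₂ _ hs₂)
    (show swept E g T₀ (v - i₁) true (n - 1) + swept E g T₀ (v + i₂) false (n - 1) < n - 1 by omega)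
  change dest _ (groupPos E g T₀ (v - i₁) true t) _ = groupPos E g T₀ (v - i₁) true t at h1
  change dest _ (groupPos E g T₀ (v + i₂) false t) _ = groupPos E g T₀ (v + i₂) false t at h2
  rw [groupPos] at h1 h2
  have hm₁ : swept E g T₀ (v - i₁) true t ≤ swept E g T₀ (v - i₁) true (n - 1) := walk_mono ht.le
  have hm₂ : swept E g T₀ (v + i₂) false t ≤ swept E g T₀ (v + i₂) false (n - 1) :=
    walk_mono ht.le
  set s₁ := swept E g T₀ (v - i₁) true t
  set s₂ := swept E g T₀ (v + i₂) false t
  have hone : (1 : ZMod n) ≠ 0 := by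
    have : Fact (1 < n) := ⟨by omega⟩
    exact one_ne_zero
  simp only [heading, dest, unit, if_true] at h1
  simp only [heading, dest, unit, Bool.false_eq_true, if_false] at h2
  split_ifs at h1 with h1'
  swap
  · simp [hone] at h1
  split_ifs at h2 with h2'
  swap
  · simp [hone] at h2
  -- the two groups stand at the two ends of the missing link, so the distances that they have
  -- covered add up to `i₁ + i₂ - 1` modulo `n`, which is more than they can be
  have h3 := Option.some_injective _ (h1'.symm.trans h2')
  have h4 : ((i₁ + i₂ - s₁ - s₂ - 1 : ℕ) : ZMod n) = ((0 : ℕ) : ZMod n) := by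
    rw [Nat.cast_sub (by omega), Nat.cast_sub (by omega), Nat.cast_sub (by omega)]
    push_cast
    linear_combination -h3
  have h5 := natCast_injOn (by omega) (by omega) h4
  omega

end Trajectories

/-! ### The sweep -/

section Sweep

variable {n k : ℕ} {E : Scenario n k} {g T₀ : ℕ}

/-- The agents at the node `v` that continue as members of the group `(d, x)`, see `joining`. -/
def joiners (m : Snapshot (AgentState n) n k) (d : Bool) (x : ℕ) (v : ZMod n) : Set (Fin k) :=
  {a | m.pos a = v ∧ (m.state a = AgentState.moving d x ∨ m.state a = AgentState.idle ∧
    (d = true ∨ ∀ b y, m.pos b = v → m.state b ≠ AgentState.moving true y))}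

/-- The agents of `J` with an ID smaller than that of `a`. -/
def before (E : Scenario n k) (J : Set (Fin k)) (a : Fin k) : Set (Fin k) :=
  {b ∈ J | E.ids b < E.ids a}

theorem ncard_ids_image (J : Set (Fin k)) : (E.ids '' J).ncard = J.ncard :=
  Set.ncard_image_of_injective _ E.ids_injective

theorem ncard_ids_image_lt (J : Set (Fin k)) (a : Fin k) :
    {i ∈ E.ids '' J | i < E.ids a}.ncard = (before E J a).ncard := by
  rw [← ncard_ids_image]
  congr 1
  ext i
  constructor
  · rintro ⟨⟨b, hb, rfl⟩, h⟩
    exact ⟨b, ⟨hb, h⟩, rfl⟩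
  · rintro ⟨b, ⟨hb, h⟩, rfl⟩
    exact ⟨⟨b, hb, rfl⟩, h⟩

theorem ncard_before_lt (J : Set (Fin k)) (r : ℕ) :
    {a ∈ J | (before E J a).ncard < r}.ncard = min r J.ncard :=
  ncard_rank_lt E.ids_injective J r

theorem ncard_le_before (J : Set (Fin k)) (r : ℕ) :
    {a ∈ J | r ≤ (before E J a).ncard}.ncard = J.ncard - r :=
  ncard_le_rank E.ids_injective J r

/-- The log of the node `v` when the agents decide in step `τ`. -/
noncomputable def logOf (E : Scenario n k) (g T₀ τ : ℕ) (v : ZMod n) : Log (AgentState n) :=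
  (gatherSnapshot E g T₀ τ).register E.ids τ v

theorem mem_logOf {τ : ℕ} {v : ZMod n} {i : ℕ} {s : AgentState n} :
    (i, s) ∈ logOf E g T₀ τ v τ ↔ ∃ a, (gatherSnapshot E g T₀ τ).pos a = v ∧
      E.ids a = i ∧ (gatherSnapshot E g T₀ τ).state a = s := by
  simp [logOf, mem_snapshot_register]

theorem idsAt_logOf {τ : ℕ} (hτ : T₀ ≤ τ) (v : ZMod n) :
    idsAt (logOf E g T₀ τ v) T₀ = E.ids '' heldBy E g T₀ v := by
  ext i
  rw [logOf, mem_idsAt_register]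
  exact ⟨fun h => h.2, fun h => ⟨hτ, h⟩⟩

theorem joining_logOf {τ : ℕ} (d : Bool) (x : ℕ) (v : ZMod n) :
    joining d x (logOf E g T₀ τ v τ) = E.ids '' joiners (gatherSnapshot E g T₀ τ) d x v := by
  ext i
  simp only [joining, Set.mem_ofPred_eq, mem_logOf]
  constructor
  · rintro (⟨a, h1, rfl, h2⟩ | ⟨⟨a, h1, rfl, h2⟩, h3⟩)
    · exact ⟨a, ⟨h1, Or.inl h2⟩, rfl⟩
    · refine ⟨a, ⟨h1, Or.inr ⟨h2, h3.imp_right fun h b y hb hy => ?_⟩⟩, rfl⟩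
      exact h (E.ids b) y ⟨b, hb, rfl, hy⟩
  · rintro ⟨a, ⟨h1, h2 | ⟨h2, h3⟩⟩, rfl⟩
    · exact Or.inl ⟨a, h1, rfl, h2⟩
    · refine Or.inr ⟨⟨a, h1, rfl, h2⟩, h3.imp_right ?_⟩
      rintro h j y ⟨b, hb, -, hy⟩
      exact h b y hb hy

theorem gatherSnapshot_succ_state (τ : ℕ) (a : Fin k) :
    (gatherSnapshot E g T₀ (τ + 1)).state a =
      (gatherRule g n T₀ τ (E.ids a) ((gatherSnapshot E g T₀ τ).state a)
        (logOf E g T₀ τ ((gatherSnapshot E g T₀ τ).pos a))).1 := rfl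

theorem gatherSnapshot_succ_pos (τ : ℕ) (a : Fin k) :
    (gatherSnapshot E g T₀ (τ + 1)).pos a =
      dest (E.missing (2 * τ + 1)) ((gatherSnapshot E g T₀ τ).pos a)
      (gatherRule g n T₀ τ (E.ids a) ((gatherSnapshot E g T₀ τ).state a)
        (logOf E g T₀ τ ((gatherSnapshot E g T₀ τ).pos a))).2 := rfl

/-- The configuration before step `j` of the sweep. -/
noncomputable abbrev sweepSnapshot (E : Scenario n k) (g T₀ j : ℕ) : Snapshot (AgentState n) n k :=
  gatherSnapshot E g T₀ (T₀ + 1 + j)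

variable (E g T₀) in
/-- The invariant of the sweep. All members of a group are where the trajectory of the group says,
every group has between `g` and `2 * g - 1` members, no group has visited an idle agent, and settled
agents are in the company of at least `g` settled agents. -/
structure SweepInvariant (j : ℕ) : Prop where
  state_eq : ∀ a, (sweepSnapshot E g T₀ j).state a = AgentState.idle ∨
    (sweepSnapshot E g T₀ j).state a = AgentState.settled ∨
    ∃ d b, IsBase E g T₀ b ∧
      (sweepSnapshot E g T₀ j).state a = AgentState.moving d (baseName E g T₀ b) ∧
      (sweepSnapshot E g T₀ j).pos a = groupPos E g T₀ b d j
  group : ∀ d b, IsBase E g T₀ b →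
    g ≤ {a | (sweepSnapshot E g T₀ j).state a = AgentState.moving d (baseName E g T₀ b)}.ncard ∧
    {a | (sweepSnapshot E g T₀ j).state a = AgentState.moving d (baseName E g T₀ b)}.ncard < 2 * g
  idle : ∀ a, (sweepSnapshot E g T₀ j).state a = AgentState.idle →
    ¬ IsBase E g T₀ ((sweepSnapshot E g T₀ j).pos a) ∧
    ∀ d b, IsBase E g T₀ b → ∀ i < j, groupPos E g T₀ b d i ≠ (sweepSnapshot E g T₀ j).pos a
  settled : ∀ a, (sweepSnapshot E g T₀ j).state a = AgentState.settled →
    g ≤ {b | (sweepSnapshot E g T₀ j).state b = AgentState.settled ∧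
      (sweepSnapshot E g T₀ j).pos b = (sweepSnapshot E g T₀ j).pos a}.ncard

theorem formRule_logOf (a : Fin k) {v : ZMod n} (hv : (gatherSnapshot E g T₀ T₀).pos a = v)
    (hw : ∃ o F, (gatherSnapshot E g T₀ T₀).state a = AgentState.walking o F) :
    (sweepSnapshot E g T₀ 0).pos a = v ∧
    (((sweepSnapshot E g T₀ 0).state a = AgentState.idle ∧ ¬ IsBase E g T₀ v) ∨
    (IsBase E g T₀ v ∧ (before E (heldBy E g T₀ v) a).ncard < g ∧
      (sweepSnapshot E g T₀ 0).state a = AgentState.moving true (baseName E g T₀ v)) ∨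
    (IsBase E g T₀ v ∧ g ≤ (before E (heldBy E g T₀ v) a).ncard ∧
      ((heldBy E g T₀ v).ncard < 3 * g ∨ (before E (heldBy E g T₀ v) a).ncard < 2 * g) ∧
      (sweepSnapshot E g T₀ 0).state a = AgentState.moving false (baseName E g T₀ v)) ∨
    (IsBase E g T₀ v ∧ 3 * g ≤ (heldBy E g T₀ v).ncard ∧
      2 * g ≤ (before E (heldBy E g T₀ v) a).ncard ∧
      (sweepSnapshot E g T₀ 0).state a = AgentState.settled)) := by
  obtain ⟨o, F, hw⟩ := hw
  have hpos : (sweepSnapshot E g T₀ 0).pos a = v := by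
    change (gatherSnapshot E g T₀ (T₀ + 1)).pos a = v
    rw [gatherSnapshot_succ_pos, hw, hv]
    simp [gatherRule, dest]
  refine ⟨hpos, ?_⟩
  have hst : (sweepSnapshot E g T₀ 0).state a = formRule g T₀ (E.ids a) (logOf E g T₀ T₀ v) := by
    change (gatherSnapshot E g T₀ (T₀ + 1)).state a = _
    rw [gatherSnapshot_succ_state, hw, hv]
    simp [gatherRule]
  simp only [formRule, idsAt_logOf le_rfl, ncard_ids_image, ncard_ids_image_lt] at hst
  rw [hst]
  simp only [IsBase, baseName]
  split_ifs with h1 h2 h3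
  · exact Or.inl ⟨rfl, by omega⟩
  · exact Or.inr (Or.inl ⟨by omega, h2, rfl⟩)
  · exact Or.inr (Or.inr (Or.inl ⟨by omega, by omega, h3, rfl⟩))
  · exact Or.inr (Or.inr (Or.inr ⟨by omega, by omega, by omega, rfl⟩))

theorem sweepInvariant_zero (hg : 1 ≤ g)
    (hw : ∀ a, ∃ o F, (gatherSnapshot E g T₀ T₀).state a = AgentState.walking o F) :
    SweepInvariant E g T₀ 0 := by
  have hpos : ∀ a, (sweepSnapshot E g T₀ 0).pos a = (gatherSnapshot E g T₀ T₀).pos a :=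
    fun a => (formRule_logOf a rfl (hw a)).1
  have hcase := fun a => (formRule_logOf a rfl (hw a)).2
  refine ⟨fun a => ?_, fun d b hb => ?_, fun a ha => ?_, fun a ha => ?_⟩
  · rcases hcase a with ⟨h, -⟩ | ⟨hb, -, h⟩ | ⟨hb, -, -, h⟩ | ⟨hb, -, -, h⟩
    · exact Or.inl h
    · exact Or.inr (Or.inr ⟨_, _, hb, h, by rw [groupPos_zero, hpos]⟩)
    · exact Or.inr (Or.inr ⟨_, _, hb, h, by rw [groupPos_zero, hpos]⟩)
    · exact Or.inr (Or.inl h)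
  · have hb' : 2 * g ≤ (heldBy E g T₀ b).ncard := hb
    set H := heldBy E g T₀ b with hH
    cases d with
    | true =>
      have hset : {a | (sweepSnapshot E g T₀ 0).state a =
          AgentState.moving true (baseName E g T₀ b)} = {a ∈ H | (before E H a).ncard < g} := by
        ext a
        simp only [Set.mem_ofPred_eq]
        constructor
        · intro h
          rcases hcase a with ⟨h', -⟩ | ⟨h1, h2, h'⟩ | ⟨-, -, -, h'⟩ | ⟨-, -, -, h'⟩ <;>
            rw [h] at h'
          · cases h'
          · have h3 := baseName_injOn hg hb h1 (AgentState.moving.inj h').2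
            rw [← h3] at h2
            exact ⟨h3.symm, h2⟩
          · exact absurd (AgentState.moving.inj h').1 (by simp)
          · cases h'
        · rintro ⟨h1, h2⟩
          have h1 : (gatherSnapshot E g T₀ T₀).pos a = b := h1
          have hc := hcase a
          rw [h1, ← hH] at hc
          rcases hc with ⟨-, h'⟩ | ⟨-, -, h'⟩ | ⟨-, h', -⟩ | ⟨-, -, h', -⟩
          · exact absurd hb h'
          · exact h'
          all_goals omega
      rw [hset, ncard_before_lt]
      omega
    | false =>
      have hset : {a | (sweepSnapshot E g T₀ 0).state a =
          AgentState.moving false (baseName E g T₀ b)} = {a ∈ H | g ≤ (before E H a).ncard ∧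
            (H.ncard < 3 * g ∨ (before E H a).ncard < 2 * g)} := by
        ext a
        simp only [Set.mem_ofPred_eq]
        constructor
        · intro h
          rcases hcase a with ⟨h', -⟩ | ⟨-, -, h'⟩ | ⟨h1, h2, h3, h'⟩ | ⟨-, -, -, h'⟩ <;>
            rw [h] at h'
          · cases h'
          · exact absurd (AgentState.moving.inj h').1 (by simp)
          · have h4 := baseName_injOn hg hb h1 (AgentState.moving.inj h').2
            rw [← h4] at h2 h3
            exact ⟨h4.symm, h2, h3⟩
          · cases h'
        · rintro ⟨h1, h2, h3⟩
          have h1 : (gatherSnapshot E g T₀ T₀).pos a = b := h1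
          have hc := hcase a
          rw [h1, ← hH] at hc
          rcases hc with ⟨-, h'⟩ | ⟨-, h', -⟩ | ⟨-, -, -, h'⟩ | ⟨-, h', h'', -⟩
          · exact absurd hb h'
          · omega
          · exact h'
          · omega
      rw [hset]
      -- the backward group has `H.ncard - g` members if `H.ncard < 3 * g`, and otherwise `g` members
      by_cases h3 : H.ncard < 3 * g
      · simp only [h3, true_or, and_true]
        rw [ncard_le_before]
        omega
      · simp only [h3, false_or]
        have hdiff : {a ∈ H | g ≤ (before E H a).ncard ∧ (before E H a).ncard < 2 * g} =
            {a ∈ H | (before E H a).ncard < 2 * g} \ {a ∈ H | (before E H a).ncard < g} := by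
          ext a
          simp only [Set.mem_ofPred_eq, Set.mem_sdiff, not_and, not_lt]
          tauto
        have hsub : {a ∈ H | (before E H a).ncard < g} ⊆ {a ∈ H | (before E H a).ncard < 2 * g} :=
          fun a ha => ⟨ha.1, lt_of_lt_of_le ha.2 (by omega)⟩
        rw [hdiff, Set.ncard_sdiff hsub (Set.toFinite _), ncard_before_lt, ncard_before_lt]
        omega
  · refine ⟨?_, fun d b _ i hi => absurd hi (by omega)⟩
    rw [hpos]
    rcases hcase a with ⟨-, h⟩ | ⟨-, -, h'⟩ | ⟨-, -, -, h'⟩ | ⟨-, -, -, h'⟩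
    · exact h
    all_goals rw [ha] at h'; cases h'
  · rcases hcase a with ⟨h', -⟩ | ⟨-, -, h'⟩ | ⟨-, -, -, h'⟩ | ⟨hb, h3, h2, -⟩
    · rw [ha] at h'; cases h'
    · rw [ha] at h'; cases h'
    · rw [ha] at h'; cases h'
    · have hc := ncard_le_before (E := E) (heldBy E g T₀ ((gatherSnapshot E g T₀ T₀).pos a)) (2 * g)
      refine le_trans (show g ≤ _ by omega) (hc.symm.le.trans
        (Set.ncard_le_ncard (fun c hc' => ?_) (Set.toFinite _)))
      obtain ⟨hc1, hc2⟩ := hc'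
      have hc1 : (gatherSnapshot E g T₀ T₀).pos c = (gatherSnapshot E g T₀ T₀).pos a := hc1
      refine ⟨?_, by rw [hpos, hpos, hc1]⟩
      have hcc := hcase c
      rw [hc1] at hcc
      rcases hcc with ⟨-, h'⟩ | ⟨-, h', -⟩ | ⟨-, -, h', -⟩ | ⟨-, -, -, h'⟩
      · exact absurd hb h'
      · omega
      · omega
      · exact h'

end Sweep

section SweepStep

variable {n k : ℕ} {E : Scenario n k} {g T₀ j : ℕ}

variable (E g T₀) in
/-- The agents that continue in step `j` of the sweep as members of the group with direction `d`
from the base `b`. -/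
def groupJoiners (j : ℕ) (d : Bool) (b : ZMod n) : Set (Fin k) :=
  joiners (sweepSnapshot E g T₀ j) d (baseName E g T₀ b) (groupPos E g T₀ b d j)

open Classical in
/-- The effect of `joinRule`: if there are at least `2 * g` joiners, then the first `g` of them move
on and the others settle. -/
theorem joinRule_logOf {τ : ℕ} (d : Bool) (x : ℕ) (v : ZMod n) (a : Fin k) :
    joinRule g d x (E.ids a) (logOf E g T₀ τ v τ) =
      if 2 * g ≤ (joiners (gatherSnapshot E g T₀ τ) d x v).ncard ∧
          g ≤ (before E (joiners (gatherSnapshot E g T₀ τ) d x v) a).ncard then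
        (AgentState.settled, Move.stay)
      else (AgentState.moving d x, heading d) := by
  simp only [joinRule, joining_logOf, ncard_ids_image, ncard_ids_image_lt]

theorem isBase_iff_idsAt {τ : ℕ} (hτ : T₀ ≤ τ) (v : ZMod n) :
    2 * g ≤ (idsAt (logOf E g T₀ τ v) T₀).ncard ↔ IsBase E g T₀ v := by
  rw [idsAt_logOf hτ, ncard_ids_image, IsBase]

theorem baseName_eq_sInf {τ : ℕ} (hτ : T₀ ≤ τ) (v : ZMod n) :
    sInf (idsAt (logOf E g T₀ τ v) T₀) = baseName E g T₀ v := by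
  rw [idsAt_logOf hτ, baseName]

theorem sweepSnapshot_succ (a : Fin k) {s : AgentState n} {p : Move}
    (h : gatherRule g n T₀ (T₀ + 1 + j) (E.ids a) ((sweepSnapshot E g T₀ j).state a)
      (logOf E g T₀ (T₀ + 1 + j) ((sweepSnapshot E g T₀ j).pos a)) = (s, p)) :
    (sweepSnapshot E g T₀ (j + 1)).state a = s ∧ (sweepSnapshot E g T₀ (j + 1)).pos a =
      dest (E.missing (2 * (T₀ + 1 + j) + 1)) ((sweepSnapshot E g T₀ j).pos a) p := by
  change (gatherSnapshot E g T₀ (T₀ + 1 + j + 1)).state a = s ∧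
    (gatherSnapshot E g T₀ (T₀ + 1 + j + 1)).pos a = _
  rw [gatherSnapshot_succ_state, gatherSnapshot_succ_pos, h]
  exact ⟨rfl, rfl⟩

namespace SweepInvariant

/-- Movers at a node outside the bases belong to a group that is there. -/
theorem exists_of_moving (h : SweepInvariant E g T₀ j) {a : Fin k} {d : Bool} {x : ℕ}
    (ha : (sweepSnapshot E g T₀ j).state a = AgentState.moving d x) :
    ∃ b, IsBase E g T₀ b ∧ x = baseName E g T₀ b ∧
      (sweepSnapshot E g T₀ j).pos a = groupPos E g T₀ b d j := by
  rcases h.state_eq a with h' | h' | ⟨d', b, hb, h', hp⟩ <;> rw [ha] at h'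
  · cases h'
  · cases h'
  · obtain ⟨rfl, rfl⟩ := AgentState.moving.inj h'
    exact ⟨b, hb, rfl, hp⟩

theorem exists_mem_group (h : SweepInvariant E g T₀ j) (hg : 1 ≤ g) (d : Bool) {b : ZMod n}
    (hb : IsBase E g T₀ b) : ∃ a, (sweepSnapshot E g T₀ j).state a =
      AgentState.moving d (baseName E g T₀ b) ∧
      (sweepSnapshot E g T₀ j).pos a = groupPos E g T₀ b d j := by
  obtain ⟨a, ha⟩ := Set.nonempty_of_ncard_ne_zero (by have := (h.group d b hb).1; omega :
    {a | (sweepSnapshot E g T₀ j).state a = AgentState.moving d (baseName E g T₀ b)}.ncard ≠ 0)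
  obtain ⟨b', hb', hname, hp⟩ := h.exists_of_moving ha
  obtain rfl := baseName_injOn hg hb hb' hname
  exact ⟨a, ha, hp⟩

theorem group_subset_joiners (h : SweepInvariant E g T₀ j) (hg : 1 ≤ g) (d : Bool) {b : ZMod n}
    (hb : IsBase E g T₀ b) :
    {a | (sweepSnapshot E g T₀ j).state a = AgentState.moving d (baseName E g T₀ b)} ⊆
      groupJoiners E g T₀ j d b := by
  intro a ha
  obtain ⟨b', hb', hname, hp⟩ := h.exists_of_moving ha
  obtain rfl := baseName_injOn hg hb hb' hname
  exact ⟨hp, Or.inl ha⟩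

theorem settled_succ {a : Fin k} (ha : (sweepSnapshot E g T₀ j).state a = AgentState.settled) :
    (sweepSnapshot E g T₀ (j + 1)).state a = AgentState.settled ∧
      (sweepSnapshot E g T₀ (j + 1)).pos a = (sweepSnapshot E g T₀ j).pos a :=
  sweepSnapshot_succ (p := Move.stay) a (by rw [ha, gatherRule])

/-- A group leaves its own base and stays at any other one. -/
theorem moving_succ_of_base (hg : 1 ≤ g) {a : Fin k} {d : Bool}
    {b : ZMod n} (hb : IsBase E g T₀ b)
    (ha : (sweepSnapshot E g T₀ j).state a = AgentState.moving d (baseName E g T₀ b))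
    (hp : (sweepSnapshot E g T₀ j).pos a = groupPos E g T₀ b d j)
    (hq : IsBase E g T₀ (groupPos E g T₀ b d j)) :
    (sweepSnapshot E g T₀ (j + 1)).state a = AgentState.moving d (baseName E g T₀ b) ∧
      (sweepSnapshot E g T₀ (j + 1)).pos a = groupPos E g T₀ b d (j + 1) := by
  have hτ : T₀ ≤ T₀ + 1 + j := by omega
  by_cases hqb : groupPos E g T₀ b d j = b
  · rw [groupPos_succ E g T₀ (fun h => h.2 hqb), ← hp]
    refine sweepSnapshot_succ a ?_
    rw [ha, gatherRule, if_pos ((isBase_iff_idsAt hτ _).2 (hp ▸ hq)), baseName_eq_sInf hτ, hp, hqb,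
      if_pos rfl]
  · rw [groupPos_succ_of_base E g T₀ hq hqb, ← hp]
    refine sweepSnapshot_succ (p := Move.stay) a ?_
    rw [ha, gatherRule, if_pos ((isBase_iff_idsAt hτ _).2 (hp ▸ hq)), baseName_eq_sInf hτ, hp,
      if_neg fun hname => hqb (baseName_injOn hg hq hb hname)]

/-- Outside the bases, the joiners of a group move on with it or settle. -/
theorem joiners_succ [NeZero n] (h : SweepInvariant E g T₀ j) (hg : 1 ≤ g) (hj : j < n)
    {a : Fin k} {d : Bool} {b : ZMod n} (hb : IsBase E g T₀ b)
    (hq : ¬ IsBase E g T₀ (groupPos E g T₀ b d j)) (ha : a ∈ groupJoiners E g T₀ j d b) :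
    (2 * g ≤ (groupJoiners E g T₀ j d b).ncard ∧
        g ≤ (before E (groupJoiners E g T₀ j d b) a).ncard →
      (sweepSnapshot E g T₀ (j + 1)).state a = AgentState.settled ∧
      (sweepSnapshot E g T₀ (j + 1)).pos a = groupPos E g T₀ b d j) ∧
    (¬ (2 * g ≤ (groupJoiners E g T₀ j d b).ncard ∧
        g ≤ (before E (groupJoiners E g T₀ j d b) a).ncard) →
      (sweepSnapshot E g T₀ (j + 1)).state a = AgentState.moving d (baseName E g T₀ b) ∧
      (sweepSnapshot E g T₀ (j + 1)).pos a = groupPos E g T₀ b d (j + 1)) := by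
  classical
  have hp : (sweepSnapshot E g T₀ j).pos a = groupPos E g T₀ b d j := ha.1
  have hτ : T₀ ≤ T₀ + 1 + j := by omega
  -- outside the bases, the name of a group is determined by its direction and its node
  have hname : {y | ∃ i, (i, AgentState.moving d y) ∈ logOf E g T₀ (T₀ + 1 + j)
        ((sweepSnapshot E g T₀ j).pos a) (T₀ + 1 + j)} = {baseName E g T₀ b} := by
    have hbp := hp.symm
    ext y
    simp only [Set.mem_ofPred_eq, Set.mem_singleton_iff, mem_logOf]
    constructor
    · rintro ⟨i, c, hc, -, hy⟩
      obtain ⟨b', hb', rfl, hp'⟩ := h.exists_of_moving hy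
      rw [groupPos_inj hj hb hb' hq (hbp.trans (hc.symm.trans hp'))]
    · rintro rfl
      obtain ⟨c, hc, hcp⟩ := h.exists_mem_group hg d hb
      exact ⟨_, c, hcp.trans hbp, rfl, hc⟩
  have hrule : gatherRule g n T₀ (T₀ + 1 + j) (E.ids a) ((sweepSnapshot E g T₀ j).state a)
      (logOf E g T₀ (T₀ + 1 + j) ((sweepSnapshot E g T₀ j).pos a)) =
      joinRule g d (baseName E g T₀ b) (E.ids a) (logOf E g T₀ (T₀ + 1 + j)
        ((sweepSnapshot E g T₀ j).pos a) (T₀ + 1 + j)) := by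
    have hex : ∃ i y, (i, AgentState.moving d y) ∈ logOf E g T₀ (T₀ + 1 + j)
        ((sweepSnapshot E g T₀ j).pos a) (T₀ + 1 + j) := by
      obtain ⟨i, hi⟩ : baseName E g T₀ b ∈ {y | ∃ i, (i, AgentState.moving d y) ∈
          logOf E g T₀ (T₀ + 1 + j) ((sweepSnapshot E g T₀ j).pos a) (T₀ + 1 + j)} := by
        rw [hname]
        rfl
      exact ⟨i, _, hi⟩
    rcases ha.2 with hs | ⟨hs, hd⟩
    · rw [hs, gatherRule, if_neg (fun hb' => hq (hp ▸ (isBase_iff_idsAt hτ _).1 hb'))]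
    · rw [hs, gatherRule]
      cases d with
      | true => rw [if_pos hex, hname, csInf_singleton]
      | false =>
        rw [if_neg, if_pos hex, hname, csInf_singleton]
        rintro ⟨i, y, hi⟩
        obtain ⟨c, hc, -, hy⟩ := mem_logOf.1 hi
        exact hd.resolve_left (by simp) c y (hc.trans hp) hy
  rw [joinRule_logOf, hp] at hrule
  constructor
  · intro hcond
    have hst := sweepSnapshot_succ (s := AgentState.settled) (p := Move.stay) a
      (by rw [hp, hrule]; exact if_pos hcond)
    exact ⟨hst.1, hst.2.trans hp⟩
  · intro hcond
    rw [groupPos_succ E g T₀ (fun h => hq h.1), ← hp]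
    exact sweepSnapshot_succ a (by rw [hp, hrule]; exact if_neg hcond)

/-- What may happen to an agent in a step of the sweep. -/
theorem step_cases [NeZero n] (h : SweepInvariant E g T₀ j) (hg : 1 ≤ g) (a : Fin k) :
    (sweepSnapshot E g T₀ j).state a = AgentState.settled ∨
    (∃ d b, IsBase E g T₀ b ∧ IsBase E g T₀ (groupPos E g T₀ b d j) ∧
      (sweepSnapshot E g T₀ j).state a = AgentState.moving d (baseName E g T₀ b) ∧
      (sweepSnapshot E g T₀ j).pos a = groupPos E g T₀ b d j) ∨
    (∃ d b, IsBase E g T₀ b ∧ ¬ IsBase E g T₀ (groupPos E g T₀ b d j) ∧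
      a ∈ groupJoiners E g T₀ j d b) ∨
    ((sweepSnapshot E g T₀ j).state a = AgentState.idle ∧
      (sweepSnapshot E g T₀ (j + 1)).state a = AgentState.idle ∧
      (sweepSnapshot E g T₀ (j + 1)).pos a = (sweepSnapshot E g T₀ j).pos a ∧
      ∀ d b, IsBase E g T₀ b → groupPos E g T₀ b d j ≠ (sweepSnapshot E g T₀ j).pos a) := by
  rcases h.state_eq a with hs | hs | ⟨d, b, hb, hs, hp⟩
  · obtain ⟨hnb, -⟩ := h.idle a hs
    by_cases ht : ∃ b, IsBase E g T₀ b ∧ groupPos E g T₀ b true j = (sweepSnapshot E g T₀ j).pos a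
    · obtain ⟨b, hb, hp⟩ := ht
      exact Or.inr (Or.inr (Or.inl ⟨true, b, hb, hp ▸ hnb, hp.symm, Or.inr ⟨hs, Or.inl rfl⟩⟩))
    have hnot : ∀ c y, (sweepSnapshot E g T₀ j).pos c = (sweepSnapshot E g T₀ j).pos a →
        (sweepSnapshot E g T₀ j).state c ≠ AgentState.moving true y := by
      intro c y hc hy
      obtain ⟨b, hb, -, hp⟩ := h.exists_of_moving hy
      exact ht ⟨b, hb, hp.symm.trans hc⟩
    by_cases hf : ∃ b, IsBase E g T₀ b ∧ groupPos E g T₀ b false j = (sweepSnapshot E g T₀ j).pos a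
    · obtain ⟨b, hb, hp⟩ := hf
      exact Or.inr (Or.inr (Or.inl ⟨false, b, hb, hp ▸ hnb, hp.symm,
        Or.inr ⟨hs, Or.inr fun c y hc => hnot c y (hc.trans hp)⟩⟩))
    have hst := sweepSnapshot_succ (j := j) (g := g) (T₀ := T₀) (s := AgentState.idle)
      (p := Move.stay) a (by
        rw [hs, gatherRule, if_neg, if_neg]
        · rintro ⟨i, y, hi⟩
          obtain ⟨c, hc, -, hy⟩ := mem_logOf.1 hi
          obtain ⟨b, hb, -, hp⟩ := h.exists_of_moving hy
          exact hf ⟨b, hb, hp.symm.trans hc⟩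
        · rintro ⟨i, y, hi⟩
          obtain ⟨c, hc, -, hy⟩ := mem_logOf.1 hi
          exact hnot c y hc hy)
    refine Or.inr (Or.inr (Or.inr ⟨hs, hst.1, hst.2, ?_⟩))
    rintro (_ | _) b hb hp
    · exact hf ⟨b, hb, hp⟩
    · exact ht ⟨b, hb, hp⟩
  · exact Or.inl hs
  · by_cases hq : IsBase E g T₀ (groupPos E g T₀ b d j)
    · exact Or.inr (Or.inl ⟨d, b, hb, hq, hs, hp⟩)
    · exact Or.inr (Or.inr (Or.inl ⟨d, b, hb, hq, h.group_subset_joiners hg d hb hs⟩))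

theorem group_succ_of_base [NeZero n] (h : SweepInvariant E g T₀ j) (hg : 1 ≤ g) (hj : j < n)
    {d : Bool} {b : ZMod n} (hb : IsBase E g T₀ b) (hq : IsBase E g T₀ (groupPos E g T₀ b d j)) :
    {a | (sweepSnapshot E g T₀ (j + 1)).state a = AgentState.moving d (baseName E g T₀ b)} =
      {a | (sweepSnapshot E g T₀ j).state a = AgentState.moving d (baseName E g T₀ b)} := by
  ext a
  simp only [Set.mem_ofPred_eq]
  constructor
  · intro ha
    rcases h.step_cases hg a with hs | ⟨d', b', hb', hq', hs, hp⟩ | ⟨d', b', hb', hq', hJ⟩ |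
      ⟨-, hs, -⟩
    · rw [(settled_succ hs).1] at ha
      cases ha
    · rw [(moving_succ_of_base hg hb' hs hp hq').1] at ha
      rw [← ha]
      exact hs
    · have hstep := h.joiners_succ hg hj hb' hq' hJ
      by_cases hc : 2 * g ≤ (groupJoiners E g T₀ j d' b').ncard ∧
        g ≤ (before E (groupJoiners E g T₀ j d' b') a).ncard
      · rw [(hstep.1 hc).1] at ha
        cases ha
      · rw [(hstep.2 hc).1] at ha
        obtain ⟨rfl, hname⟩ := AgentState.moving.inj ha
        obtain rfl := baseName_injOn hg hb' hb hname
        exact absurd hq hq'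
    · rw [hs] at ha
      cases ha
  · intro ha
    obtain ⟨b', hb', hname, hp⟩ := h.exists_of_moving ha
    obtain rfl := baseName_injOn hg hb hb' hname
    exact (moving_succ_of_base hg hb ha hp hq).1

theorem group_succ_of_not_base [NeZero n] (h : SweepInvariant E g T₀ j) (hg : 1 ≤ g) (hj : j < n)
    {d : Bool} {b : ZMod n} (hb : IsBase E g T₀ b)
    (hq : ¬ IsBase E g T₀ (groupPos E g T₀ b d j)) :
    {a | (sweepSnapshot E g T₀ (j + 1)).state a = AgentState.moving d (baseName E g T₀ b)} =
      {a ∈ groupJoiners E g T₀ j d b | ¬ (2 * g ≤ (groupJoiners E g T₀ j d b).ncard ∧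
        g ≤ (before E (groupJoiners E g T₀ j d b) a).ncard)} := by
  ext a
  simp only [Set.mem_ofPred_eq]
  constructor
  · intro ha
    rcases h.step_cases hg a with hs | ⟨d', b', hb', hq', hs, hp⟩ | ⟨d', b', hb', hq', hJ⟩ |
      ⟨-, hs, -⟩
    · rw [(settled_succ hs).1] at ha
      cases ha
    · rw [(moving_succ_of_base hg hb' hs hp hq').1] at ha
      obtain ⟨rfl, hname⟩ := AgentState.moving.inj ha
      obtain rfl := baseName_injOn hg hb' hb hname
      exact absurd hq' hq
    · have hstep := h.joiners_succ hg hj hb' hq' hJ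
      by_cases hc : 2 * g ≤ (groupJoiners E g T₀ j d' b').ncard ∧
        g ≤ (before E (groupJoiners E g T₀ j d' b') a).ncard
      · rw [(hstep.1 hc).1] at ha
        cases ha
      · rw [(hstep.2 hc).1] at ha
        obtain ⟨rfl, hname⟩ := AgentState.moving.inj ha
        obtain rfl := baseName_injOn hg hb' hb hname
        exact ⟨hJ, hc⟩
    · rw [hs] at ha
      cases ha
  · rintro ⟨hJ, hc⟩
    exact ((h.joiners_succ hg hj hb hq hJ).2 hc).1

/-- The invariant of the sweep is preserved. -/
theorem succ [NeZero n] (h : SweepInvariant E g T₀ j) (hg : 1 ≤ g) (hj : j < n) :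
    SweepInvariant E g T₀ (j + 1) := by
  refine ⟨fun a => ?_, fun d b hb => ?_, fun a ha => ?_, fun a ha => ?_⟩
  · rcases h.step_cases hg a with hs | ⟨d, b, hb, hq, hs, hp⟩ | ⟨d, b, hb, hq, hJ⟩ | ⟨-, hs, -⟩
    · exact Or.inr (Or.inl (settled_succ hs).1)
    · exact Or.inr (Or.inr ⟨d, b, hb, moving_succ_of_base hg hb hs hp hq⟩)
    · have hstep := h.joiners_succ hg hj hb hq hJ
      by_cases hc : 2 * g ≤ (groupJoiners E g T₀ j d b).ncard ∧
        g ≤ (before E (groupJoiners E g T₀ j d b) a).ncard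
      · exact Or.inr (Or.inl (hstep.1 hc).1)
      · exact Or.inr (Or.inr ⟨d, b, hb, hstep.2 hc⟩)
    · exact Or.inl hs
  · by_cases hq : IsBase E g T₀ (groupPos E g T₀ b d j)
    · rw [h.group_succ_of_base hg hj hb hq]
      exact h.group d b hb
    · rw [h.group_succ_of_not_base hg hj hb hq]
      have hle := Set.ncard_le_ncard (h.group_subset_joiners hg d hb) (Set.toFinite _)
      have hge := (h.group d b hb).1
      by_cases hc : 2 * g ≤ (groupJoiners E g T₀ j d b).ncard
      · simp only [hc, true_and, not_le]
        rw [ncard_before_lt]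
        omega
      · simp only [hc, false_and, not_false_iff, and_true, Set.ofPred_mem_eq]
        omega
  · rcases h.step_cases hg a with hs | ⟨d, b, hb, hq, hs, hp⟩ | ⟨d, b, hb, hq, hJ⟩ |
      ⟨hs, -, hp, hne⟩
    · rw [(settled_succ hs).1] at ha
      cases ha
    · rw [(moving_succ_of_base hg hb hs hp hq).1] at ha
      cases ha
    · have hstep := h.joiners_succ hg hj hb hq hJ
      by_cases hc : 2 * g ≤ (groupJoiners E g T₀ j d b).ncard ∧
        g ≤ (before E (groupJoiners E g T₀ j d b) a).ncard
      · rw [(hstep.1 hc).1] at ha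
        cases ha
      · rw [(hstep.2 hc).1] at ha
        cases ha
    · rw [hp]
      obtain ⟨h1, h2⟩ := h.idle a hs
      refine ⟨h1, fun d b hb i hi => ?_⟩
      rcases Nat.lt_or_eq_of_le (Nat.le_of_lt_succ hi) with hlt | rfl
      · exact h2 d b hb i hlt
      · exact hne d b hb
  · rcases h.step_cases hg a with hs | ⟨d, b, hb, hq, hs, hp⟩ | ⟨d, b, hb, hq, hJ⟩ | ⟨-, hs, -⟩
    · refine (h.settled a hs).trans (Set.ncard_le_ncard ?_ (Set.toFinite _))
      rintro c ⟨hc, hcp⟩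
      exact ⟨(settled_succ hc).1, by rw [(settled_succ hc).2, (settled_succ hs).2, hcp]⟩
    · rw [(moving_succ_of_base hg hb hs hp hq).1] at ha
      cases ha
    · have hstep := h.joiners_succ hg hj hb hq hJ
      by_cases hc : 2 * g ≤ (groupJoiners E g T₀ j d b).ncard ∧
        g ≤ (before E (groupJoiners E g T₀ j d b) a).ncard
      · have hcard := ncard_le_before (E := E) (groupJoiners E g T₀ j d b) g
        refine (show g ≤ _ by omega : g ≤ (groupJoiners E g T₀ j d b).ncard - g).trans
          (hcard.symm.le.trans (Set.ncard_le_ncard ?_ (Set.toFinite _)))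
        rintro c ⟨hcJ, hcr⟩
        have hcs := (h.joiners_succ hg hj hb hq hcJ).1 ⟨hc.1, hcr⟩
        exact ⟨hcs.1, hcs.2.trans (hstep.1 hc).2.symm⟩
      · rw [(hstep.2 hc).1] at ha
        cases ha
    · rw [hs] at ha
      cases ha

/-- Agents that change their node belong to a group that advances. -/
theorem exists_of_pos_ne [NeZero n] (h : SweepInvariant E g T₀ j) (hg : 1 ≤ g) (hj : j < n)
    {a : Fin k} (ha : (sweepSnapshot E g T₀ (j + 1)).pos a ≠ (sweepSnapshot E g T₀ j).pos a) :
    ∃ d b, IsBase E g T₀ b ∧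
      (sweepSnapshot E g T₀ (j + 1)).state a = AgentState.moving d (baseName E g T₀ b) ∧
      swept E g T₀ b d (j + 1) = swept E g T₀ b d j + 1 := by
  rcases h.step_cases hg a with hs | ⟨d, b, hb, hq, hs, hp⟩ | ⟨d, b, hb, hq, hJ⟩ | ⟨-, -, hp, -⟩
  · exact absurd (settled_succ hs).2 ha
  · have hstep := moving_succ_of_base hg hb hs hp hq
    rw [hstep.2, hp] at ha
    exact ⟨d, b, hb, hstep.1, swept_succ_of_ne E g T₀ ha⟩
  · have hstep := h.joiners_succ hg hj hb hq hJ
    rw [show (sweepSnapshot E g T₀ j).pos a = _ from hJ.1] at ha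
    by_cases hc : 2 * g ≤ (groupJoiners E g T₀ j d b).ncard ∧
      g ≤ (before E (groupJoiners E g T₀ j d b) a).ncard
    · exact absurd (hstep.1 hc).2 ha
    · rw [(hstep.2 hc).2] at ha
      exact ⟨d, b, hb, (hstep.2 hc).1, swept_succ_of_ne E g T₀ ha⟩
  · exact absurd hp ha

end SweepInvariant

end SweepStep

/-! ### Upper bounds -/

section Gathering

variable {n k : ℕ} {E : Scenario n k} {g T₀ : ℕ}

theorem sweepInvariant_of_le [NeZero n] (hg : 1 ≤ g)
    (hw : ∀ a, ∃ o F, (gatherSnapshot E g T₀ T₀).state a = AgentState.walking o F) {j : ℕ}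
    (hj : j ≤ n) : SweepInvariant E g T₀ j := by
  induction j with
  | zero => exact sweepInvariant_zero hg hw
  | succ j ih => exact (ih (by omega)).succ hg (by omega)

/-- After `n` steps of the sweep no agent is idle any more, so the groups and the settled agents are
gathered. -/
theorem SweepInvariant.gathered [NeZero n] (hn : 2 ≤ n) (hg : 1 ≤ g) (h : SweepInvariant E g T₀ n)
    {b₀ : ZMod n} (hb₀ : IsBase E g T₀ b₀) (a : Fin k) :
    g ≤ (Finset.univ.filter fun b =>
      (sweepSnapshot E g T₀ n).pos b = (sweepSnapshot E g T₀ n).pos a).card := by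
  rw [← Set.ncard_coe_finset]
  rcases h.state_eq a with hs | hs | ⟨d, b, hb, hs, hp⟩
  · obtain ⟨hnb, hne⟩ := h.idle a hs
    obtain ⟨b, d, j, hj, hb, hp⟩ := exists_groupPos_eq hn hnb hb₀
    exact absurd hp (hne d b hb j hj)
  · refine (h.settled a hs).trans (Set.ncard_le_ncard (fun c hc => ?_) (Set.toFinite _))
    simpa using hc.2
  · refine (h.group d b hb).1.trans (Set.ncard_le_ncard (fun c hc => ?_) (Set.toFinite _))
    have hc' := (h.group_subset_joiners hg d hb hc).1
    simpa using hc'.trans hp.symm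

/-- Each group has less than `2 * g` members, and the groups of each direction pass every link at
most once. -/
theorem sum_moves_sweep [NeZero n] (hg : 1 ≤ g)
    (hw : ∀ a, ∃ o F, (gatherSnapshot E g T₀ T₀).state a = AgentState.walking o F) :
    ∑ j ∈ Finset.range n, (Finset.univ.filter fun a =>
      (sweepSnapshot E g T₀ (j + 1)).pos a ≠ (sweepSnapshot E g T₀ j).pos a).card ≤
      4 * g * n := by
  classical
  let B : Finset (Bool × ZMod n) := Finset.univ ×ˢ Finset.univ.filter (IsBase E g T₀)
  have hstep : ∀ j < n, (Finset.univ.filter fun a =>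
      (sweepSnapshot E g T₀ (j + 1)).pos a ≠ (sweepSnapshot E g T₀ j).pos a).card ≤
      ∑ p ∈ B, 2 * g * (swept E g T₀ p.2 p.1 (j + 1) - swept E g T₀ p.2 p.1 j) := by
    intro j hj
    have hinv := sweepInvariant_of_le hg hw hj.le
    have hinv' := sweepInvariant_of_le hg hw (show j + 1 ≤ n from hj)
    let G : Bool × ZMod n → Finset (Fin k) := fun p =>
      if swept E g T₀ p.2 p.1 (j + 1) = swept E g T₀ p.2 p.1 j + 1 then
        Finset.univ.filter fun a => (sweepSnapshot E g T₀ (j + 1)).state a =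
          AgentState.moving p.1 (baseName E g T₀ p.2)
      else ∅
    have hsub : (Finset.univ.filter fun a =>
        (sweepSnapshot E g T₀ (j + 1)).pos a ≠ (sweepSnapshot E g T₀ j).pos a) ⊆ B.biUnion G := by
      intro a ha
      obtain ⟨d, b, hb, hs, hsw⟩ := hinv.exists_of_pos_ne hg hj (Finset.mem_filter.1 ha).2
      refine Finset.mem_biUnion.2 ⟨(d, b), by simp [B, hb], ?_⟩
      simp only [G, hsw, if_true]
      simp [hs]
    refine (Finset.card_le_card hsub).trans (Finset.card_biUnion_le.trans
      (Finset.sum_le_sum fun p hp => ?_))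
    have hb : IsBase E g T₀ p.2 := by simpa [B] using hp
    simp only [G]
    split_ifs with hsw
    · have hlt := (hinv'.group p.1 p.2 hb).2
      rw [← Set.ncard_coe_finset, hsw, Nat.add_sub_cancel_left, mul_one]
      simpa using hlt.le
    · simp
  calc _ ≤ ∑ j ∈ Finset.range n, ∑ p ∈ B,
        2 * g * (swept E g T₀ p.2 p.1 (j + 1) - swept E g T₀ p.2 p.1 j) :=
        Finset.sum_le_sum fun j hj => hstep j (Finset.mem_range.1 hj)
    _ = ∑ p ∈ B, 2 * g * swept E g T₀ p.2 p.1 n := by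
        rw [Finset.sum_comm]
        refine Finset.sum_congr rfl fun p _ => ?_
        rw [← Finset.mul_sum,
          Finset.sum_range_tsub (show Monotone (swept E g T₀ p.2 p.1) from walk_mono)]
        simp [swept, walk]
    _ = ∑ d : Bool, 2 * g * ∑ b ∈ Finset.univ.filter (IsBase E g T₀), swept E g T₀ b d n := by
        rw [Finset.sum_product]
        simp only [Finset.mul_sum]
    _ ≤ ∑ _d : Bool, 2 * g * n :=
        Finset.sum_le_sum fun d _ => Nat.mul_le_mul_left _ (sum_swept_le d)
    _ = 4 * g * n := by
        simp only [Finset.sum_const, Finset.card_univ, Fintype.card_bool, smul_eq_mul]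
        ring

end Gathering

/-- The algorithm: `2 * n` steps of walking, one step for the formation of groups, `n` steps of
sweeping. -/
theorem exists_solvesWithin {g n k : ℕ} (hg : 1 ≤ g) (hk : 8 * g - 3 ≤ k) (hkn : k ≤ n) :
    ∃ A : Algorithm, A.IsFinite ∧ A.SolvesWithin g n k (12 * n) (12 * (g * n)) := by
  have hn : 2 ≤ n := by omega
  have : NeZero n := ⟨by omega⟩
  have hT : 0 < 2 * n + 1 + n := by omega
  refine ⟨logAlgorithm (AgentState.walking 0 ∅) (2 * n + 1 + n) (gatherRule g n (2 * n)),
    logAlgorithm_isFinite _ hT _ (gatherRule_finite g n (2 * n)), fun E => ?_⟩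
  have hwalk := fun a => snapshot_walk E hg hk (le_refl (2 * n)) a
  have hw : ∀ a, ∃ o F, (gatherSnapshot E g (2 * n) (2 * n)).state a = AgentState.walking o F :=
    fun a => ⟨_, _, (hwalk a).2⟩
  obtain ⟨v, hv⟩ : ∃ v, IsBase E g (2 * n) v := by
    obtain ⟨v, hv⟩ := exists_base E hg hk
    refine ⟨v, hv.trans_eq (congrArg Set.ncard ?_)⟩
    ext a
    simp only [heldBy, Set.mem_ofPred_eq, (hwalk a).1]
  refine ⟨2 * (2 * n + 1 + n), by omega, allTerminated_logAlgorithm _ _ _ E hT, ?_, ?_⟩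
  · intro a
    rw [config_two_mul _ _ _ E hT le_rfl]
    exact (sweepInvariant_of_le hg hw le_rfl).gathered hn hg hv a
  · rw [totalMoves_logAlgorithm _ _ _ E hT le_rfl, Finset.sum_range_add, Finset.sum_range_succ]
    have h1 := sum_moves_walk E (T₀ := 2 * n) hg hk
    have h2 := sum_moves_sweep (E := E) hg hw
    have h3 : (Finset.univ.filter fun a => (gatherSnapshot E g (2 * n) (2 * n + 1)).pos a ≠
        (gatherSnapshot E g (2 * n) (2 * n)).pos a).card = 0 := by
      rw [Finset.card_eq_zero, Finset.filter_eq_empty_iff]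
      intro a _
      exact not_not.2 (formRule_logOf a rfl (hw a)).1
    calc _ ≤ 8 * g * n + 0 + 4 * g * n := Nat.add_le_add (Nat.add_le_add h1 h3.le) h2
      _ = 12 * (g * n) := by ring

end DynamicRing


theorem theorem6 :
    -- upper bounds: `O(n)` rounds and `O(g n)` moves suffice
    (∃ C : ℕ, ∀ g n k : ℕ, 1 ≤ g → 8 * g - 3 ≤ k → k ≤ n →
      ∃ A : DynamicRing.Algorithm, A.IsFinite ∧ A.SolvesWithin g n k (C * n) (C * (g * n))) ∧
    -- optimality of the moves: every algorithm needs `Ω(g n)` moves in the worst case (`g ≥ 2`)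
    (∃ C : ℕ, ∀ g n k : ℕ, 2 ≤ g → 8 * g - 3 ≤ k → k ≤ n →
      ∀ A : DynamicRing.Algorithm, A.Solves g n k →
        ∃ E : DynamicRing.Scenario n k, ∀ T, DynamicRing.AllTerminated A E T →
          g * n ≤ C * DynamicRing.totalMoves A E T) ∧
    -- optimality of the time: every algorithm needs `Ω(n)` rounds in the worst case
    (∃ C : ℕ, ∀ g n k : ℕ, 2 ≤ g → 8 * g - 3 ≤ k → 2 * k ≤ n →
      ∀ A : DynamicRing.Algorithm, A.Solves g n k →
        ∃ E : DynamicRing.Scenario n k, ∀ T, DynamicRing.AllTerminated A E T → n ≤ C * T) :=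
  ⟨⟨12, fun _ _ _ hg hk hkn => DynamicRing.exists_solvesWithin hg hk hkn⟩,
    ⟨24, fun _ _ _ hg hk hkn A hA => DynamicRing.exists_many_moves hg (by omega) hkn A hA⟩,
    ⟨8, fun _ _ _ hg hk hkn A hA => DynamicRing.exists_many_rounds hg (by omega) hkn A hA⟩⟩
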